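/- Write points of $\mathbb{R}^{2n}$ as $(x,y)$ with $x,y\in\mathbb{R}^n$, and let $\omega=\sum_i dx_i\wedge dy_i$. For open sets $U,V\subset\mathbb{R}^{2n}$, a symplectic embedding $U\to V$ is a smooth injective map $f:U\to V$ with $f^*\omega=\omega$. For $R>0$ let $B^{2n}(R)=\{(x,y):\pi(\|x\|^2+\|y\|^2)<R\}$ and $Z^{2n}(R)=\{(x,y):\pi(x_1^2+y_1^2)<R\}$, where $\|\cdot\|$ is the Euclidean norm. A symplectic capacity is a map $c$ from the open subsets of $\mathbb{R}^{2n}$ to $[0,\infty]$ such that (1) $c(U)\le c(V)$ whenever there is a symplectic embedding $U\to V$; (2) $c(\lambda U)=\lambda^2c(U)$ for all $\lambda>0$; (3) $0<c(B^{2n}(1))\le c(Z^{2n}(1))<\infty$. It is normalized if $c(B^{2n}(1))=c(Z^{2n}(1))=1$. The Gromov width is $Gr(U)=\sup\{R>0: B^{2n}(R)\text{ embeds symplectically into }U\}$ and the cylindrical capacity is $c_Z(U)=\inf\{R>0: U\text{ embeds symplectically into }Z^{2n}(R)\}$. Let $2\le p<\infty$, let $$X_p=\{(x,y)\in\mathbb{R}^2\times\mathbb{R}^2=\mathbb{R}^4:\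 \|x\|^p+\|y\|^p<1\},\qquad a_p=\frac{4\,\Gamma(1+\frac1p)^2}{\Gamma(1+\frac2p)}.$$ Then all normalized symplectic capacities on $\mathbb{R}^4$ coincide on $X_p$, with common value $a_p$: every normalized symplectic capacity $c$ satisfies $c(X_p)=a_p$. Moreover, $a_p\le Gr(X_p)$ and $c_Z(X_p)\le a_p$. -/

import Mathlib

open scoped ENNReal Pointwise

namespace SymplecticCapacity

/-- The standard phase space `ℝ²ⁿ = ℝⁿ × ℝⁿ` with points `z = (x, y)`; both factors carry the
Euclidean norm. (The product norm that Lean puts on the pair is used only for the topology and the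
differential calculus, for which all norms on `ℝ²ⁿ` are equivalent.) -/
abbrev PhaseSpace (n : ℕ) : Type := EuclideanSpace ℝ (Fin n) × EuclideanSpace ℝ (Fin n)

/-- The standard symplectic form `ω = ∑ dxᵢ ∧ dyᵢ`. -/
def omega {n : ℕ} (u v : PhaseSpace n) : ℝ :=
  ∑ i, (u.1 i * v.2 i - u.2 i * v.1 i)

/-- `f` restricts to a smooth symplectic embedding of the open set `U` into the open set `V`.
(An injective smooth map with `f^*ω = ω` between open sets of the same dimension is a
diffeomorphism onto an open image.) -/
structure IsSymplecticEmbedding {n : ℕ} (U V : TopologicalSpace.Opens (PhaseSpace n))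
    (f : PhaseSpace n → PhaseSpace n) : Prop where
  contDiffOn : ContDiffOn ℝ ((⊤ : ℕ∞) : WithTop ℕ∞) f (U : Set (PhaseSpace n))
  mapsTo : Set.MapsTo f U V
  injOn : Set.InjOn f U
  pullback : ∀ z ∈ U, ∀ u v : PhaseSpace n, omega (fderiv ℝ f z u) (fderiv ℝ f z v) = omega u v

/-- There is a symplectic embedding `U → V`. -/
def SymplecticallyEmbeds {n : ℕ} (U V : TopologicalSpace.Opens (PhaseSpace n)) : Prop :=
  ∃ f : PhaseSpace n → PhaseSpace n, IsSymplecticEmbedding U V f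

/-- The open ball `B²ⁿ(R) = {z | π ‖z‖² < R}` of capacity `R`. -/
def ball (n : ℕ) (R : ℝ) : TopologicalSpace.Opens (PhaseSpace n) :=
  ⟨{z | Real.pi * (‖z.1‖ ^ 2 + ‖z.2‖ ^ 2) < R}, isOpen_lt (by fun_prop) continuous_const⟩

/-- The open symplectic cylinder `Z²ⁿ(R) = B²(R) × ℝ²ⁿ⁻²`, the disc lying in the symplectic plane
of the first conjugate pair of coordinates. -/
def cylinder (n : ℕ) [NeZero n] (R : ℝ) : TopologicalSpace.Opens (PhaseSpace n) :=
  ⟨{z | Real.pi * (z.1 0 ^ 2 + z.2 0 ^ 2) < R}, isOpen_lt (by fun_prop) continuous_const⟩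

/-- The rescaled open set `r U = {r z | z ∈ U}`, for `r > 0`. -/
def rescale {n : ℕ} (r : ℝ) (hr : 0 < r) (U : TopologicalSpace.Opens (PhaseSpace n)) :
    TopologicalSpace.Opens (PhaseSpace n) :=
  ⟨r • (U : Set (PhaseSpace n)), U.isOpen.smul₀ hr.ne'⟩

/-- Symplectic capacities on the open subsets of `ℝ²ⁿ`. -/
structure IsSymplecticCapacity {n : ℕ} [NeZero n]
    (c : TopologicalSpace.Opens (PhaseSpace n) → ℝ≥0∞) : Prop where
  monotone : ∀ U V, SymplecticallyEmbeds U V → c U ≤ c V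
  rescaling : ∀ (r : ℝ) (hr : 0 < r) (U : TopologicalSpace.Opens (PhaseSpace n)),
    c (rescale r hr U) = ENNReal.ofReal (r ^ 2) * c U
  ball_pos : 0 < c (ball n 1)
  ball_le_cylinder : c (ball n 1) ≤ c (cylinder n 1)
  cylinder_lt_top : c (cylinder n 1) < ⊤

/-- Normalized symplectic capacities. -/
structure IsNormalizedCapacity {n : ℕ} [NeZero n]
    (c : TopologicalSpace.Opens (PhaseSpace n) → ℝ≥0∞) : Prop extends IsSymplecticCapacity c where
  ball_eq_one : c (ball n 1) = 1
  cylinder_eq_one : c (cylinder n 1) = 1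

/-- The Gromov width `sup {R > 0 | B²ⁿ(R) embeds symplectically into U}`, with values in `[0, ∞]`. -/
noncomputable def gromovWidth {n : ℕ} (U : TopologicalSpace.Opens (PhaseSpace n)) : ℝ≥0∞ :=
  sSup {a | ∃ R : ℝ, 0 < R ∧ SymplecticallyEmbeds (ball n R) U ∧ a = ENNReal.ofReal R}

/-- The cylindrical capacity `inf {R > 0 | U embeds symplectically into Z²ⁿ(R)}`, with values in
`[0, ∞]` (and `inf ∅ = ∞`). -/
noncomputable def cylindricalCapacity {n : ℕ} [NeZero n]
    (U : TopologicalSpace.Opens (PhaseSpace n)) : ℝ≥0∞ :=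
  sInf {a | ∃ R : ℝ, 0 < R ∧ SymplecticallyEmbeds U (cylinder n R) ∧ a = ENNReal.ofReal R}

/-- The `p`-sum `{(x, y) ∈ ℝ²ⁿ | ‖x‖ᵖ + ‖y‖ᵖ < 1}` of two Euclidean Lagrangian unit balls. -/
def lagrangianPSum (n : ℕ) (p : ℝ) (hp : 0 < p) : TopologicalSpace.Opens (PhaseSpace n) :=
  ⟨{z | ‖z.1‖ ^ p + ‖z.2‖ ^ p < 1},
    isOpen_lt ((continuous_fst.norm.rpow_const fun _ => Or.inr hp.le).add
      (continuous_snd.norm.rpow_const fun _ => Or.inr hp.le)) continuous_const⟩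

end SymplecticCapacity

/-!
An increasing function `X` of the first coordinate, or of the distance to the origin in the base
`ℝⁿ`, lifts to a symplectic embedding of the cotangent bundle `ℝⁿ × ℝⁿ`. Take for `X` the map from
`(-1, 1)` to itself that matches the fractions of the areas which vertical lines cut off from the
`ℓ^q` and the `ℓᵖ` unit discs: where `X` stretches by `X'`, the lift shrinks the fibre by `X'`, and
this is exactly the ratio of the heights of the two discs up to the ratio of their areas. Hence area
is the only obstruction. In one coordinate this puts `X_p` into the cylinder over a disc of the same
area, up to an arbitrarily small loss that pays for making `X` smooth, and linear near `0`.

For the radial map, which sends a ball (`q = 2`) into `X_p`, the fibre directions orthogonal to the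
radius are shrunk by `X r / r` instead of `X' r`, so that the rectangle under the point `X r` of the
`ℓᵖ` circle must not be smaller, relative to the area of the disc, than that under the point `r` of
the `ℓ^q` circle. In terms of the parameter `v = xᵖ`, the relative areas of the sector and of the
rectangle at the boundary point `(v^(1/p), (1 - v)^(1/p))` trace a concave curve whose tangent at
`v` has slope `2 (1 - 2 v)` whatever `p` is, and these tangents move up as `p` increases.
-/

namespace SymplecticCapacity

open Set Filter Topology
open scoped ContDiff

section OneVariable

variable {f g X D : ℝ → ℝ} {a b l η : ℝ} {s : Set ℝ}

lemma exists_flattening (hη1 : η < 1) (hf0 : ContinuousAt f 0) (hpos : ∀ r ∈ Ioo (-l) l, 0 < f r)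
    (hsm : ∀ r ∈ Ioo (-l) l, r ≠ 0 → ContDiffAt ℝ ∞ f r) :
    ∃ g : ℝ → ℝ, ContDiffOn ℝ ∞ g (Ioo (-l) l) ∧ (∃ k, ∀ᶠ r in 𝓝 0, g r = k) ∧
      ∀ r ∈ Ioo (-l) l, η * f r ≤ g r ∧ g r ≤ f r := by
  rcases le_or_gt l 0 with hl | hl
  · have hempty : Ioo (-l) l = ∅ := Ioo_eq_empty (by linarith)
    exact ⟨0, contDiffOn_const, ⟨0, .of_forall fun _ => rfl⟩, by simp [hempty]⟩
  have hf : 0 < f 0 := hpos 0 ⟨by linarith, hl⟩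
  obtain ⟨k, hk, hk'⟩ : ∃ k, η * f 0 < k ∧ k < f 0 := exists_between (by nlinarith)
  have hnear : ∀ᶠ r in 𝓝 0, η * f r < k ∧ k < f r :=
    ((continuousAt_const.mul hf0).eventually_lt continuousAt_const hk).and
      (continuousAt_const.eventually_lt hf0 hk')
  obtain ⟨d, hd, hball⟩ := Metric.eventually_nhds_iff.1 hnear
  let χ : ContDiffBump (0 : ℝ) := ⟨d / 2, d, by positivity, by linarith⟩
  have hconst : ∀ᶠ r in 𝓝 0, χ r * k + (1 - χ r) * f r = k := by
    filter_upwards [χ.eventuallyEq_one] with r hr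
    simp only [hr, Pi.one_apply, one_mul, sub_self, zero_mul, add_zero]
  refine ⟨fun r => χ r * k + (1 - χ r) * f r, fun r hr => ContDiffAt.contDiffWithinAt ?_,
    ⟨k, hconst⟩, fun r hr => ?_⟩
  · rcases eq_or_ne r 0 with rfl | h
    · exact contDiffAt_const.congr_of_eventuallyEq hconst
    · exact (χ.contDiffAt.mul contDiffAt_const).add
        ((contDiffAt_const.sub χ.contDiffAt).mul (hsm r hr h))
  · have hfr := hpos r hr
    have hχ0 : 0 ≤ χ r := χ.nonneg
    have hχ1 : χ r ≤ 1 := χ.le_one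
    dsimp only
    by_cases h : dist r 0 < d
    · obtain ⟨h1, h2⟩ := hball h
      constructor <;> nlinarith [mul_nonneg (sub_nonneg.2 hχ1) (mul_pos (sub_pos.2 hη1) hfr).le]
    · rw [χ.zero_of_le_dist (not_lt.1 h)]
      constructor <;> nlinarith

lemma hasDerivAt_primitive (hs : IsOpen s) (hconn : s.OrdConnected) (hg : ContinuousOn g s)
    (ha : a ∈ s) (hb : b ∈ s) : HasDerivAt (fun y => ∫ r in a..y, g r) (g b) b :=
  intervalIntegral.integral_hasDerivAt_right
    (hg.mono (hconn.uIcc_subset ha hb)).intervalIntegrable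
    (hg.stronglyMeasurableAtFilter hs b hb) (hg.continuousAt (hs.mem_nhds hb))

lemma contDiffOn_infty_of_hasDerivAt (hs : IsOpen s) (hf : ∀ r ∈ s, HasDerivAt f (D r) r)
    (hD : ContDiffOn ℝ ∞ D s) : ContDiffOn ℝ ∞ f s := by
  rw [contDiffOn_infty_iff_deriv_of_isOpen hs]
  exact ⟨fun r hr => (hf r hr).differentiableAt.differentiableWithinAt,
    hD.congr fun r hr => (hf r hr).deriv⟩

lemma monotoneOn_of_hasDerivAt_nonneg (hs : Convex ℝ s) (hf : ∀ r ∈ s, HasDerivAt f (D r) r)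
    (hD : ∀ r ∈ s, 0 ≤ D r) : MonotoneOn f s :=
  monotoneOn_of_hasDerivWithinAt_nonneg hs (fun r hr => (hf r hr).continuousAt.continuousWithinAt)
    (fun r hr => (hf r (interior_subset hr)).hasDerivWithinAt)
    fun r hr => hD r (interior_subset hr)

lemma monotoneOn_Icc_of_hasDerivAt_nonneg (hfc : ContinuousOn f (Icc a b))
    (hf : ∀ r ∈ Ioo a b, HasDerivAt f (D r) r) (hD : ∀ r ∈ Ioo a b, 0 ≤ D r) :
    MonotoneOn f (Icc a b) := by
  rw [← interior_Icc] at hf hD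
  exact monotoneOn_of_hasDerivWithinAt_nonneg (convex_Icc a b) hfc
    (fun r hr => (hf r hr).hasDerivWithinAt) hD

lemma abs_le_abs_of_deriv_le_deriv {D' : ℝ → ℝ} (hf : ∀ r ∈ Ioo (-l) l, HasDerivAt f (D r) r)
    (hg : ∀ r ∈ Ioo (-l) l, HasDerivAt g (D' r) r) (hf0 : f 0 = 0) (hg0 : g 0 = 0)
    (hD : ∀ r ∈ Ioo (-l) l, 0 ≤ D r) (hle : ∀ r ∈ Ioo (-l) l, D r ≤ D' r) {r : ℝ}
    (hr : r ∈ Ioo (-l) l) : |f r| ≤ |g r| := by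
  have h0 : (0 : ℝ) ∈ Ioo (-l) l := ⟨by linarith [hr.1, hr.2], by linarith [hr.1, hr.2]⟩
  have hfm := monotoneOn_of_hasDerivAt_nonneg (convex_Ioo (-l) l) hf hD
  have hgm := monotoneOn_of_hasDerivAt_nonneg (convex_Ioo (-l) l)
    (fun r hr => (hg r hr).sub (hf r hr)) fun r hr => sub_nonneg.2 (hle r hr)
  rcases le_total 0 r with h | h
  · have h1 := hfm h0 hr h
    have h2 := hgm h0 hr h
    simp only [Pi.sub_apply, hf0, hg0] at h1 h2
    rw [abs_of_nonneg h1, abs_of_nonneg (by linarith)]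
    linarith
  · have h1 := hfm hr h0 h
    have h2 := hgm hr h0 h
    simp only [Pi.sub_apply, hf0, hg0] at h1 h2
    rw [abs_of_nonpos h1, abs_of_nonpos (by linarith)]
    linarith

lemma dslope_zero_mul (hg0 : g 0 = 0) (r : ℝ) : dslope g 0 r * r = g r := by
  simpa [hg0, mul_comm] using sub_smul_dslope g 0 r

lemma dslope_pos_of_deriv_pos (hs : IsOpen s) (hconv : Convex ℝ s) (hgc : ContinuousOn g s)
    (hg' : ∀ r ∈ s, 0 < deriv g r) (ha : a ∈ s) (hb : b ∈ s) : 0 < dslope g a b := by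
  rcases eq_or_ne b a with rfl | h
  · rw [dslope_same]
    exact hg' b hb
  · rw [dslope_of_ne g h]
    exact (strictMonoOn_of_deriv_pos hconv hgc (by rwa [hs.interior_eq])).slope_pos ha hb h.symm

lemma dslope_zero_comp_mul_left (hb : b ≠ 0) (r : ℝ) :
    dslope (fun r => g (b * r)) 0 r = b * dslope g 0 (b * r) := by
  rcases eq_or_ne r 0 with rfl | h
  · rw [dslope_same, deriv_comp_mul_left, mul_zero, dslope_same, smul_eq_mul]
  · rw [dslope_of_ne _ h, dslope_of_ne _ (mul_ne_zero hb h), slope_def_field, slope_def_field]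
    simp only [mul_zero, sub_zero]
    field_simp

lemma eventually_deriv_eq {k : ℝ} (hg : ∀ᶠ r in 𝓝 0, g r = k * r) :
    ∀ᶠ r in 𝓝 0, deriv g r = k := by
  filter_upwards [hg.eventually_nhds] with r hr
  have hr : g =ᶠ[𝓝 r] fun t => k * t := hr
  rw [hr.deriv_eq]
  simp

lemma eventually_dslope_zero_eq {k : ℝ} (hg : ∀ᶠ r in 𝓝 0, g r = k * r) :
    ∀ᶠ r in 𝓝 0, dslope g 0 r = k := by
  filter_upwards [hg] with r hr
  rcases eq_or_ne r 0 with rfl | h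
  · rw [dslope_same, (eventually_deriv_eq hg).self_of_nhds]
  · have hg0 : g 0 = 0 := by simpa using hg.self_of_nhds
    rw [dslope_of_ne g h, slope_def_field, hr, hg0, sub_zero, sub_zero, mul_div_cancel_right₀ k h]

lemma contDiffAt_dslope_of_ne {n : ℕ∞ω} (hg : ContDiffAt ℝ n g b) (h : b ≠ a) :
    ContDiffAt ℝ n (dslope g a) b :=
  (((contDiffAt_id.sub contDiffAt_const).inv (sub_ne_zero.2 h)).smul
    (hg.sub contDiffAt_const)).congr_of_eventuallyEq (dslope_eventuallyEq_slope_of_ne g h)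

lemma deriv_eq_dslope_zero_add (hg0 : g 0 = 0) (hg : DifferentiableAt ℝ g b) (h : b ≠ 0) :
    deriv g b = dslope g 0 b + deriv (dslope g 0) b * b := by
  have hprod := ((differentiableAt_dslope_of_ne h).2 hg).hasDerivAt.mul (hasDerivAt_id b)
  rw [show dslope g 0 * id = g from funext (dslope_zero_mul hg0)] at hprod
  rw [hprod.deriv, mul_one, add_comm, id]

lemma eventually_primitive_eq_mul {k : ℝ} (hg : ∀ᶠ r in 𝓝 0, g r = k) :
    ∀ᶠ r in 𝓝 0, ∫ t in (0 : ℝ)..r, g t = k * r := by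
  obtain ⟨d, hd, hball⟩ := Metric.eventually_nhds_iff_ball.1 hg
  filter_upwards [Metric.ball_mem_nhds 0 hd] with r hr
  have hsub : uIcc 0 r ⊆ Metric.ball 0 d := by
    rw [Real.ball_eq_Ioo] at hr ⊢
    exact ordConnected_Ioo.uIcc_subset (by simpa using hd) hr
  rw [intervalIntegral.integral_congr fun t ht => hball t (hsub ht),
    intervalIntegral.integral_const, smul_eq_mul, sub_zero, mul_comm]

lemma exists_smoothing (hη : 0 < η) (hη1 : η < 1) (hX : ∀ r ∈ Ioo (-l) l, HasDerivAt X (D r) r)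
    (hX0 : X 0 = 0) (hpos : ∀ r ∈ Ioo (-l) l, 0 < D r) (hD0 : ContinuousAt D 0)
    (hsm : ∀ r ∈ Ioo (-l) l, r ≠ 0 → ContDiffAt ℝ ∞ D r) :
    ∃ Y : ℝ → ℝ, ContDiffOn ℝ ∞ Y (Ioo (-l) l) ∧ (∃ k, ∀ᶠ r in 𝓝 0, Y r = k * r) ∧
      ∀ r ∈ Ioo (-l) l, (η * D r ≤ deriv Y r ∧ deriv Y r ≤ D r) ∧
        η * |X r| ≤ |Y r| ∧ |Y r| ≤ |X r| := by
  obtain ⟨g, hg, ⟨k, hk⟩, hle⟩ := exists_flattening hη1 hD0 hpos hsm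
  have hY : ∀ r ∈ Ioo (-l) l, HasDerivAt (fun y => ∫ t in (0 : ℝ)..y, g t) (g r) r := fun r hr =>
    hasDerivAt_primitive isOpen_Ioo ordConnected_Ioo hg.continuousOn
      ⟨by linarith [hr.1, hr.2], by linarith [hr.1, hr.2]⟩ hr
  have hY0 : ∫ t in (0 : ℝ)..0, g t = 0 := intervalIntegral.integral_same
  have hηD : ∀ r ∈ Ioo (-l) l, 0 ≤ η * D r := fun r hr => (mul_pos hη (hpos r hr)).le
  refine ⟨fun y => ∫ t in (0 : ℝ)..y, g t, contDiffOn_infty_of_hasDerivAt isOpen_Ioo hY hg,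
    ⟨k, eventually_primitive_eq_mul hk⟩,
    fun r hr => ⟨by rw [(hY r hr).deriv]; exact hle r hr, ?_, ?_⟩⟩
  · rw [← abs_of_pos hη, ← abs_mul]
    exact abs_le_abs_of_deriv_le_deriv (fun r hr => (hX r hr).const_mul η) hY (by simp [hX0]) hY0
      hηD (fun r hr => (hle r hr).1) hr
  · exact abs_le_abs_of_deriv_le_deriv hY hX hY0 hX0
      (fun r hr => (hηD r hr).trans (hle r hr).1) (fun r hr => (hle r hr).2) hr

lemma exists_image_sub_eq_mul_image_sub {φ f' g' : ℝ → ℝ} (hab : a < b)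
    (hfc : ContinuousOn f (Icc a b)) (hgc : ContinuousOn g (Icc a b))
    (hf : ∀ r ∈ Ioo a b, HasDerivAt f (f' r) r) (hg : ∀ r ∈ Ioo a b, HasDerivAt g (g' r) r)
    (hφ : ∀ r ∈ Ioo a b, f' r = φ r * g' r) (hg' : ∀ r ∈ Ioo a b, 0 < g' r) :
    ∃ c ∈ Ioo a b, f b - f a = φ c * (g b - g a) := by
  obtain ⟨c, hc, h⟩ := exists_ratio_hasDerivAt_eq_ratio_slope f f' hab hfc hf g g' hgc hg
  refine ⟨c, hc, mul_right_cancel₀ (hg' c hc).ne' ?_⟩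
  rw [← h, hφ c hc]
  ring

/-- The curve `(g, f)` lies below its chord, since its slope `φ` is monotone. -/
lemma sub_mul_sub_le_of_monotone_ratio {φ f' g' : ℝ → ℝ}
    (hfc : ContinuousOn f (Icc a b)) (hgc : ContinuousOn g (Icc a b))
    (hf : ∀ r ∈ Ioo a b, HasDerivAt f (f' r) r) (hg : ∀ r ∈ Ioo a b, HasDerivAt g (g' r) r)
    (hφ : ∀ r ∈ Ioo a b, f' r = φ r * g' r) (hg' : ∀ r ∈ Ioo a b, 0 < g' r)
    (hmono : MonotoneOn φ (Ioo a b)) {x : ℝ} (hx : x ∈ Icc a b) :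
    (f x - f a) * (g b - g a) ≤ (f b - f a) * (g x - g a) := by
  rcases hx.1.eq_or_lt with rfl | hax
  · simp
  rcases hx.2.eq_or_lt with rfl | hxb
  · rfl
  have hlsub : Ioo a x ⊆ Ioo a b := Ioo_subset_Ioo_right hx.2
  have hrsub : Ioo x b ⊆ Ioo a b := Ioo_subset_Ioo_left hx.1
  have hlc : Icc a x ⊆ Icc a b := Icc_subset_Icc_right hx.2
  have hrc : Icc x b ⊆ Icc a b := Icc_subset_Icc_left hx.1
  have hgmono : StrictMonoOn g (Icc a b) := strictMonoOn_of_hasDerivWithinAt_pos (convex_Icc a b)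
    hgc (fun r hr => (hg r (interior_Icc (a := a) (b := b) ▸ hr)).hasDerivWithinAt)
    fun r hr => hg' r (interior_Icc (a := a) (b := b) ▸ hr)
  obtain ⟨c, hc, hleft⟩ := exists_image_sub_eq_mul_image_sub hax (hfc.mono hlc) (hgc.mono hlc)
    (fun r hr => hf r (hlsub hr)) (fun r hr => hg r (hlsub hr)) (fun r hr => hφ r (hlsub hr))
    fun r hr => hg' r (hlsub hr)
  obtain ⟨d, hd, hright⟩ := exists_image_sub_eq_mul_image_sub hxb (hfc.mono hrc)
    (hgc.mono hrc) (fun r hr => hf r (hrsub hr)) (fun r hr => hg r (hrsub hr))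
    (fun r hr => hφ r (hrsub hr)) fun r hr => hg' r (hrsub hr)
  have hcd : φ c ≤ φ d := hmono (hlsub hc) (hrsub hd) (hc.2.trans hd.1).le
  have hga : 0 < g x - g a :=
    sub_pos.2 (hgmono (left_mem_Icc.2 (hax.trans hxb).le) hx hax)
  have hgb : 0 < g b - g x :=
    sub_pos.2 (hgmono hx (right_mem_Icc.2 (hax.trans hxb).le) hxb)
  calc (f x - f a) * (g b - g a)
      = (f x - f a) * (g x - g a) + φ c * ((g x - g a) * (g b - g x)) := by rw [hleft]; ring
    _ ≤ (f x - f a) * (g x - g a) + φ d * ((g x - g a) * (g b - g x)) := by gcongr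
    _ = (f b - f a) * (g x - g a) := by linear_combination (-(g x - g a)) * hright

lemma contDiffAt_of_local_left_inverse {n : ℕ∞} (hn : n ≠ 0) {f' x : ℝ} (hf : ContDiffAt ℝ n f x)
    (hf' : HasDerivAt f f' x) (hne : f' ≠ 0) (hgf : ∀ᶠ y in 𝓝 x, g (f y) = y) :
    ContDiffAt ℝ n g (f x) := by
  have hstrict := (hf.hasStrictDerivAt' hf' (by exact_mod_cast hn)).hasStrictFDerivAt_equiv hne
  exact (hf.to_localInverse hstrict.hasFDerivAt (by exact_mod_cast hn)).congr_of_eventuallyEq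
    (hstrict.localInverse_unique hgf)

end OneVariable

section Profile

/-- The profile `s ↦ (1 - |s|ᵖ)^(1/p)`, whose graph is the upper half of the `ℓᵖ` unit circle. -/
noncomputable def lpProfile (p s : ℝ) : ℝ := (1 - |s| ^ p) ^ (1 / p)

/-- The area under the `ℓᵖ` unit circle between the abscissae `0` and `x`; so `lpSlice p 1` is a
quarter of the area of the `ℓᵖ` unit disc. -/
noncomputable def lpSlice (p x : ℝ) : ℝ := ∫ s in (0 : ℝ)..x, lpProfile p s

/-- `lpSlice` as a fraction of the area of the quarter disc. -/
noncomputable def relSlice (p x : ℝ) : ℝ := lpSlice p x / lpSlice p 1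

variable {p s t : ℝ}

lemma lpProfile_neg (p s : ℝ) : lpProfile p (-s) = lpProfile p s := by
  simp only [lpProfile, abs_neg]

lemma lpProfile_of_nonneg (p : ℝ) (hs : 0 ≤ s) : lpProfile p s = (1 - s ^ p) ^ (1 / p) := by
  rw [lpProfile, abs_of_nonneg hs]

lemma abs_rpow_lt_one (hp : 0 < p) (hs : s ∈ Ioo (-1 : ℝ) 1) : |s| ^ p < 1 :=
  Real.rpow_lt_one (abs_nonneg s) (abs_lt.2 hs) hp

lemma lpProfile_pos (hp : 0 < p) (hs : s ∈ Ioo (-1 : ℝ) 1) : 0 < lpProfile p s :=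
  Real.rpow_pos_of_pos (sub_pos.2 (abs_rpow_lt_one hp hs)) _

lemma lpProfile_le_lpProfile (hp : 0 < p) (hst : |s| ≤ |t|) (ht : t ∈ Ioo (-1 : ℝ) 1) :
    lpProfile p t ≤ lpProfile p s := by
  have hpow : |s| ^ p ≤ |t| ^ p := by gcongr
  exact Real.rpow_le_rpow (sub_pos.2 (abs_rpow_lt_one hp ht)).le (by linarith) (by positivity)

lemma continuous_lpProfile (hp : 0 < p) : Continuous (lpProfile p) :=
  (continuous_const.sub (continuous_abs.rpow_const fun _ => Or.inr hp.le)).rpow_const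
    fun _ => Or.inr (by positivity)

lemma contDiffAt_lpProfile (hp : 0 < p) (hs : s ∈ Ioo (-1 : ℝ) 1) (h0 : s ≠ 0) :
    ContDiffAt ℝ ∞ (lpProfile p) s :=
  (contDiffAt_const.sub ((contDiffAt_abs h0).rpow_const_of_ne (abs_ne_zero.2 h0))).rpow_const_of_ne
    (sub_pos.2 (abs_rpow_lt_one hp hs)).ne'

lemma abs_lt_lpProfile_iff (hp : 0 < p) (hs : s ∈ Ioo (-1 : ℝ) 1) :
    |t| < lpProfile p s ↔ |s| ^ p + |t| ^ p < 1 := by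
  rw [lpProfile, one_div, Real.lt_rpow_inv_iff_of_pos (abs_nonneg t)
    (sub_pos.2 (abs_rpow_lt_one hp hs)).le hp, lt_sub_iff_add_lt']

lemma mem_Ioo_of_abs_rpow_add_lt_one (hp : 0 < p) (h : |s| ^ p + |t| ^ p < 1) :
    s ∈ Ioo (-1 : ℝ) 1 := by
  have ht : 0 ≤ |t| ^ p := by positivity
  exact abs_lt.1 ((Real.rpow_lt_one_iff' (abs_nonneg s) hp).1 (by linarith))

lemma hasStrictDerivAt_lpSlice (hp : 0 < p) (x : ℝ) :
    HasStrictDerivAt (lpSlice p) (lpProfile p x) x :=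
  (continuous_lpProfile hp).integral_hasStrictDerivAt 0 x

lemma lpSlice_one_pos (hp : 0 < p) : 0 < lpSlice p 1 :=
  intervalIntegral.intervalIntegral_pos_of_pos_on
    ((continuous_lpProfile hp).intervalIntegrable 0 1)
    (fun _ hs => lpProfile_pos hp ⟨by linarith [hs.1], hs.2⟩) one_pos

lemma relSlice_zero (p : ℝ) : relSlice p 0 = 0 := by
  rw [relSlice, lpSlice, intervalIntegral.integral_same, zero_div]

lemma relSlice_one (hp : 0 < p) : relSlice p 1 = 1 := div_self (lpSlice_one_pos hp).ne'

lemma relSlice_neg (p x : ℝ) : relSlice p (-x) = -relSlice p x := by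
  have h := intervalIntegral.integral_comp_neg (a := -x) (b := 0) (lpProfile p)
  simp only [lpProfile_neg, neg_zero, neg_neg] at h
  rw [relSlice, relSlice, ← neg_div]
  congr 1
  rw [lpSlice, lpSlice, intervalIntegral.integral_symm, h]

lemma hasStrictDerivAt_relSlice (hp : 0 < p) (x : ℝ) :
    HasStrictDerivAt (relSlice p) (lpProfile p x / lpSlice p 1) x :=
  (hasStrictDerivAt_lpSlice hp x).div_const _

lemma continuous_relSlice (hp : 0 < p) : Continuous (relSlice p) :=
  continuous_iff_continuousAt.2 fun x => (hasStrictDerivAt_relSlice hp x).hasDerivAt.continuousAt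

lemma contDiffAt_relSlice (hp : 0 < p) {x : ℝ} (hx : x ∈ Ioo (-1 : ℝ) 1) (h0 : x ≠ 0) :
    ContDiffAt ℝ ∞ (relSlice p) x := by
  have hopen : IsOpen (Ioo (-1 : ℝ) 1 ∩ {0}ᶜ) := isOpen_Ioo.inter isOpen_compl_singleton
  have hsm : ContDiffOn ℝ ∞ (relSlice p) (Ioo (-1 : ℝ) 1 ∩ {0}ᶜ) :=
    contDiffOn_infty_of_hasDerivAt hopen (fun y _ => (hasStrictDerivAt_relSlice hp y).hasDerivAt)
      fun y hy => ((contDiffAt_lpProfile hp hy.1 hy.2).div_const _).contDiffWithinAt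
  exact hsm.contDiffAt (hopen.mem_nhds ⟨hx, h0⟩)

lemma strictMonoOn_relSlice (hp : 0 < p) : StrictMonoOn (relSlice p) (Icc (-1) 1) := by
  refine strictMonoOn_of_deriv_pos (convex_Icc _ _) (continuous_relSlice hp).continuousOn
    fun x hx => ?_
  rw [(hasStrictDerivAt_relSlice hp x).hasDerivAt.deriv]
  exact div_pos (lpProfile_pos hp (interior_Icc (a := (-1 : ℝ)) ▸ hx)) (lpSlice_one_pos hp)

lemma bijOn_relSlice (hp : 0 < p) : BijOn (relSlice p) (Ioo (-1) 1) (Ioo (-1) 1) := by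
  have hmono := strictMonoOn_relSlice hp
  have hl : relSlice p (-1) = -1 := by rw [relSlice_neg, relSlice_one hp]
  refine ⟨fun x hx => ?_, (hmono.mono Ioo_subset_Icc_self).injOn, ?_⟩
  · have hx' := Ioo_subset_Icc_self hx
    exact ⟨hl ▸ hmono (by simp) hx' hx.1, relSlice_one hp ▸ hmono hx' (by simp) hx.2⟩
  · have hivt := intermediate_value_Ioo (by norm_num : (-1 : ℝ) ≤ 1)
      (continuous_relSlice hp).continuousOn
    rwa [hl, relSlice_one hp] at hivt

end Profile

section BoundaryComparison

/-- The area of the rectangle spanned by the origin and the boundary point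
`(v^(1/p), (1 - v)^(1/p))` of the `ℓᵖ` unit disc, as a fraction of the area of the quarter disc. -/
noncomputable def relRect (p v : ℝ) : ℝ := (v * (1 - v)) ^ (1 / p) / lpSlice p 1

/-- The area of the sector of the `ℓᵖ` unit disc between the vertical axis and the boundary point
`(v^(1/p), (1 - v)^(1/p))`, as a fraction of the area of the quarter disc. -/
noncomputable def relSector (p v : ℝ) : ℝ := relSlice p (v ^ (1 / p)) - relRect p v / 2

/-- The common factor of the derivatives of `relSector p` and `relRect p`. -/
noncomputable def sectorDensity (p v : ℝ) : ℝ :=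
  (v * (1 - v)) ^ (1 / p - 1) / (2 * p * lpSlice p 1)

/-- The value at sector area `0` of the tangent at the parameter `v` to the curve
`(relSector p, relRect p)`; the slope `2 * (1 - 2 * v)` of that tangent does not depend on `p`. -/
noncomputable def tangentIntercept (p v : ℝ) : ℝ := relRect p v - 2 * (1 - 2 * v) * relSector p v

variable {p q v w x r : ℝ}

lemma relRect_one_sub (p v : ℝ) : relRect p (1 - v) = relRect p v := by
  rw [relRect, relRect, sub_sub_cancel, mul_comm]

lemma continuous_relRect (hp : 0 < p) : Continuous (relRect p) :=
  ((continuous_id.mul (continuous_const.sub continuous_id)).rpow_const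
    fun _ => Or.inr (by positivity)).div_const _

lemma continuous_relSector (hp : 0 < p) : Continuous (relSector p) :=
  ((continuous_relSlice hp).comp (continuous_id.rpow_const fun _ => Or.inr (by positivity))).sub
    ((continuous_relRect hp).div_const 2)

lemma mul_one_sub_pos (hv : v ∈ Ioo (0 : ℝ) 1) : 0 < v * (1 - v) :=
  mul_pos hv.1 (sub_pos.2 hv.2)

lemma sectorDensity_pos (hp : 0 < p) (hv : v ∈ Ioo (0 : ℝ) 1) : 0 < sectorDensity p v :=
  div_pos (Real.rpow_pos_of_pos (mul_one_sub_pos hv) _) (by have := lpSlice_one_pos hp; positivity)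

lemma hasDerivAt_relRect (hp : 0 < p) (hv : v ∈ Ioo (0 : ℝ) 1) :
    HasDerivAt (relRect p) (2 * (1 - 2 * v) * sectorDensity p v) v := by
  have hK := (lpSlice_one_pos hp).ne'
  have hpoly : HasDerivAt (fun v : ℝ => v * (1 - v)) (1 - 2 * v) v :=
    ((hasDerivAt_id v).mul ((hasDerivAt_id v).const_sub 1)).congr_deriv (by simp; ring)
  refine ((hpoly.rpow_const (Or.inl (mul_one_sub_pos hv).ne')).div_const _).congr_deriv ?_
  rw [sectorDensity]
  field_simp

lemma hasDerivAt_relSector (hp : 0 < p) (hv : v ∈ Ioo (0 : ℝ) 1) :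
    HasDerivAt (relSector p) (sectorDensity p v) v := by
  have hK := (lpSlice_one_pos hp).ne'
  have hv1 : 0 < 1 - v := sub_pos.2 hv.2
  have hprofile : lpProfile p (v ^ (1 / p)) = (1 - v) ^ (1 / p - 1) * (1 - v) := by
    rw [lpProfile_of_nonneg p (Real.rpow_nonneg hv.1.le _), ← Real.rpow_mul hv.1.le,
      one_div_mul_cancel hp.ne', Real.rpow_one, ← Real.rpow_add_one hv1.ne', sub_add_cancel]
  have hslice := (hasStrictDerivAt_relSlice hp (v ^ (1 / p))).hasDerivAt.comp v
    (Real.hasDerivAt_rpow_const (p := 1 / p) (Or.inl hv.1.ne'))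
  refine (hslice.sub ((hasDerivAt_relRect hp hv).div_const 2)).congr_deriv ?_
  rw [hprofile, sectorDensity, Real.mul_rpow hv.1.le hv1.le]
  field_simp
  ring

lemma hasDerivAt_tangentIntercept (hp : 0 < p) (hv : v ∈ Ioo (0 : ℝ) 1) :
    HasDerivAt (tangentIntercept p) (4 * relSector p v) v := by
  have hslope : HasDerivAt (fun v : ℝ => 2 * (1 - 2 * v)) (-4) v :=
    ((((hasDerivAt_id v).const_mul 2).const_sub 1).const_mul 2).congr_deriv (by norm_num)
  refine ((hasDerivAt_relRect hp hv).sub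
    (hslope.mul (hasDerivAt_relSector hp hv))).congr_deriv ?_
  ring

lemma relSector_zero (hp : 0 < p) : relSector p 0 = 0 := by
  simp [relSector, relRect, relSlice_zero, Real.zero_rpow, hp.ne']

lemma tangentIntercept_zero (hp : 0 < p) : tangentIntercept p 0 = 0 := by
  simp [tangentIntercept, relRect, relSector_zero hp, Real.zero_rpow, hp.ne']

lemma relSector_one (hp : 0 < p) : relSector p 1 = 1 := by
  simp [relSector, relRect, relSlice_one hp, Real.zero_rpow, hp.ne']

lemma one_sub_mem_Ioo (hv : v ∈ Ioo (0 : ℝ) 1) : 1 - v ∈ Ioo (0 : ℝ) 1 :=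
  ⟨by linarith [hv.2], by linarith [hv.1]⟩

lemma relSector_one_sub (hp : 0 < p) (hv : v ∈ Icc (0 : ℝ) 1) :
    relSector p (1 - v) = 1 - relSector p v := by
  have hcont : Continuous fun v => relSector p (1 - v) + relSector p v :=
    ((continuous_relSector hp).comp (continuous_const.sub continuous_id)).add
      (continuous_relSector hp)
  have hder : ∀ v ∈ Ioo (0 : ℝ) 1,
      HasDerivAt (fun v => relSector p (1 - v) + relSector p v) 0 v := by
    intro v hv
    refine (((hasDerivAt_relSector hp (one_sub_mem_Ioo hv)).comp v
      ((hasDerivAt_id v).const_sub 1)).add (hasDerivAt_relSector hp hv)).congr_deriv ?_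
    rw [sectorDensity, sectorDensity, sub_sub_cancel, mul_comm (1 - v)]
    ring
  have hmono := monotoneOn_Icc_of_hasDerivAt_nonneg hcont.continuousOn hder fun _ _ => le_rfl
  have h0 := hmono (left_mem_Icc.2 zero_le_one) hv hv.1
  have h1 := hmono hv (right_mem_Icc.2 zero_le_one) hv.2
  simp only [sub_zero, sub_self, relSector_zero hp, relSector_one hp] at h0 h1
  linarith

lemma monotoneOn_relSector (hp : 0 < p) : MonotoneOn (relSector p) (Icc 0 1) :=
  monotoneOn_Icc_of_hasDerivAt_nonneg (continuous_relSector hp).continuousOn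
    (fun _ hv => hasDerivAt_relSector hp hv) fun _ hv => (sectorDensity_pos hp hv).le

lemma relSector_half (hp : 0 < p) : relSector p (1 / 2) = 1 / 2 := by
  have h := relSector_one_sub hp (v := 1 / 2) (by norm_num)
  norm_num at h ⊢
  linarith

lemma relSector_le_relSector (hq : 0 < q) (hqp : q ≤ p) (hv : v ∈ Icc (0 : ℝ) (1 / 2)) :
    relSector q v ≤ relSector p v := by
  have hp := hq.trans_le hqp
  have hKp := lpSlice_one_pos hp
  have hKq := lpSlice_one_pos hq
  have hsub : ∀ v ∈ Ioo (0 : ℝ) (1 / 2), v ∈ Ioo (0 : ℝ) 1 := fun v hv =>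
    ⟨hv.1, hv.2.trans (by norm_num)⟩
  have hexp : 0 ≤ 1 / q - 1 / p := sub_nonneg.2 (one_div_le_one_div_of_le hq hqp)
  have hchord := sub_mul_sub_le_of_monotone_ratio
    (φ := fun v => p * lpSlice p 1 / (q * lpSlice q 1) * (v * (1 - v)) ^ (1 / q - 1 / p))
    (continuous_relSector hq).continuousOn (continuous_relSector hp).continuousOn
    (fun v hv => hasDerivAt_relSector hq (hsub v hv))
    (fun v hv => hasDerivAt_relSector hp (hsub v hv)) (fun v hv => ?_)
    (fun v hv => sectorDensity_pos hp (hsub v hv)) (fun v hv w hw hvw => ?_) hv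
  · simp only [relSector_zero hp, relSector_zero hq, relSector_half hp, relSector_half hq] at hchord
    linarith
  · rw [sectorDensity, sectorDensity,
      show 1 / q - 1 = 1 / q - 1 / p + (1 / p - 1) by ring,
      Real.rpow_add (mul_one_sub_pos (hsub v hv))]
    field_simp
  · have hbase : v * (1 - v) ≤ w * (1 - w) := by nlinarith [hv.2, hw.2]
    have := (mul_one_sub_pos (hsub v hv)).le
    dsimp only
    gcongr

lemma tangentIntercept_one_sub (hp : 0 < p) (hv : v ∈ Icc (0 : ℝ) 1) :
    tangentIntercept p (1 - v) = tangentIntercept p v + 2 * (1 - 2 * v) := by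
  rw [tangentIntercept, tangentIntercept, relRect_one_sub, relSector_one_sub hp hv]
  ring

lemma continuous_tangentIntercept (hp : 0 < p) : Continuous (tangentIntercept p) :=
  (continuous_relRect hp).sub
    ((continuous_const.mul (continuous_const.sub (continuous_const.mul continuous_id))).mul
      (continuous_relSector hp))

lemma tangentIntercept_le_tangentIntercept (hq : 0 < q) (hqp : q ≤ p) (hv : v ∈ Icc (0 : ℝ) 1) :
    tangentIntercept q v ≤ tangentIntercept p v := by
  have hp := hq.trans_le hqp
  have hhalf : ∀ v ∈ Icc (0 : ℝ) (1 / 2), tangentIntercept q v ≤ tangentIntercept p v := by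
    intro v hv
    have hsub : ∀ v ∈ Ioo (0 : ℝ) (1 / 2), v ∈ Ioo (0 : ℝ) 1 := fun v hv =>
      ⟨hv.1, hv.2.trans (by norm_num)⟩
    have hmono := monotoneOn_Icc_of_hasDerivAt_nonneg
      ((continuous_tangentIntercept hp).sub (continuous_tangentIntercept hq)).continuousOn
      (fun v hv => (hasDerivAt_tangentIntercept hp (hsub v hv)).sub
        (hasDerivAt_tangentIntercept hq (hsub v hv)))
      fun v hv => by linarith [relSector_le_relSector hq hqp (Ioo_subset_Icc_self hv)]
    have h := hmono (left_mem_Icc.2 (by norm_num)) hv hv.1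
    simp only [Pi.sub_apply, tangentIntercept_zero hp, tangentIntercept_zero hq] at h
    linarith
  rcases le_total v (1 / 2) with h | h
  · exact hhalf v ⟨hv.1, h⟩
  · have h1 := hhalf (1 - v) ⟨by linarith [hv.2], by linarith⟩
    rw [tangentIntercept_one_sub hp hv, tangentIntercept_one_sub hq hv] at h1
    linarith

lemma tangentIntercept_add_le (hp : 0 < p) (hv : v ∈ Icc (0 : ℝ) 1) (hw : w ∈ Icc (0 : ℝ) 1) :
    tangentIntercept p w + 4 * relSector p w * (v - w) ≤ tangentIntercept p v := by
  have hcont := fun a b : ℝ => (continuous_tangentIntercept hp).continuousOn (s := Icc a b)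
  have hS := monotoneOn_relSector hp
  rcases lt_trichotomy v w with h | rfl | h
  · obtain ⟨c, hc, hslope⟩ := exists_hasDerivAt_eq_slope _ _ h (hcont v w) fun u hu =>
      hasDerivAt_tangentIntercept hp ⟨hv.1.trans_lt hu.1, hu.2.trans_le hw.2⟩
    rw [eq_div_iff (sub_pos.2 h).ne'] at hslope
    nlinarith [hS ⟨hv.1.trans hc.1.le, hc.2.le.trans hw.2⟩ hw hc.2.le]
  · simp
  · obtain ⟨c, hc, hslope⟩ := exists_hasDerivAt_eq_slope _ _ h (hcont w v) fun u hu =>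
      hasDerivAt_tangentIntercept hp ⟨hw.1.trans_lt hu.1, hu.2.trans_le hv.2⟩
    rw [eq_div_iff (sub_pos.2 h).ne'] at hslope
    nlinarith [hS hw ⟨hw.1.trans hc.1.le, hc.2.le.trans hv.2⟩ hc.1.le]

lemma mul_relSector_sub_le_relRect_sub (hq : 0 < q) (hqp : q ≤ p) (hv : v ∈ Icc (0 : ℝ) 1)
    (hw : w ∈ Icc (0 : ℝ) 1) :
    2 * (1 - 2 * v) * (relSector p v - relSector q w) ≤ relRect p v - relRect q w := by
  have h1 := tangentIntercept_le_tangentIntercept hq hqp hv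
  have h2 := tangentIntercept_add_le hq hv hw
  simp only [tangentIntercept] at h1 h2
  linarith

lemma relRect_rpow (hp : 0 < p) (hx : x ∈ Icc (0 : ℝ) 1) :
    relRect p (x ^ p) = x * lpProfile p x / lpSlice p 1 := by
  rw [relRect, lpProfile_of_nonneg p hx.1,
    Real.mul_rpow (by have := hx.1; positivity) (sub_nonneg.2 (Real.rpow_le_one hx.1 hx.2 hp.le)),
    one_div, Real.rpow_rpow_inv hx.1 hp.ne']

lemma relSector_rpow (hp : 0 < p) (hx : 0 ≤ x) :
    relSector p (x ^ p) = relSlice p x - relRect p (x ^ p) / 2 := by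
  rw [relSector, one_div, Real.rpow_rpow_inv hx hp.ne']

/-- Points cutting off the same slice have sectors and rectangles that differ by opposite amounts,
so that the comparison of tangents decides the sign. -/
lemma relRect_le_relRect_of_relSlice_eq (hq : 0 < q) (hqp : q ≤ p) (hx : x ∈ Ico (0 : ℝ) 1)
    (hr : r ∈ Ico (0 : ℝ) 1) (h : relSlice p x = relSlice q r) :
    relRect q (r ^ q) ≤ relRect p (x ^ p) := by
  have hp := hq.trans_le hqp
  have hx1 : x ^ p < 1 := Real.rpow_lt_one hx.1 hx.2 hp
  have htangent := mul_relSector_sub_le_relRect_sub hq hqp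
    (v := x ^ p) (w := r ^ q) ⟨Real.rpow_nonneg hx.1 p, hx1.le⟩
    ⟨Real.rpow_nonneg hr.1 q, (Real.rpow_lt_one hr.1 hr.2 hq).le⟩
  rw [relSector_rpow hp hx.1, relSector_rpow hq hr.1, h] at htangent
  have : 0 ≤ (2 - 2 * x ^ p) * (relRect p (x ^ p) - relRect q (r ^ q)) := by linarith
  nlinarith [nonneg_of_mul_nonneg_right this (by linarith)]

end BoundaryComparison

section Transport

/-- The abscissa `x` that cuts off from the `ℓᵖ` unit disc the same fraction of area as `r` cuts off
from the `ℓ^q` unit disc; only its values for `|r| < 1` are meaningful. -/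
noncomputable def lpTransport (q p r : ℝ) : ℝ :=
  Function.invFunOn (relSlice p) (Ioo (-1) 1) (relSlice q r)

/-- The derivative of `lpTransport q p`. -/
noncomputable def lpTransportDensity (q p r : ℝ) : ℝ :=
  lpProfile q r / lpSlice q 1 / (lpProfile p (lpTransport q p r) / lpSlice p 1)

variable {p q r c : ℝ}

lemma lpTransport_mem (hq : 0 < q) (hp : 0 < p) (hr : r ∈ Ioo (-1 : ℝ) 1) :
    lpTransport q p r ∈ Ioo (-1 : ℝ) 1 :=
  Function.invFunOn_mem ((bijOn_relSlice hp).surjOn ((bijOn_relSlice hq).mapsTo hr))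

lemma relSlice_lpTransport (hq : 0 < q) (hp : 0 < p) (hr : r ∈ Ioo (-1 : ℝ) 1) :
    relSlice p (lpTransport q p r) = relSlice q r :=
  Function.invFunOn_eq ((bijOn_relSlice hp).surjOn ((bijOn_relSlice hq).mapsTo hr))

lemma lpTransport_zero (hp : 0 < p) (q : ℝ) : lpTransport q p 0 = 0 := by
  have h := (bijOn_relSlice hp).injOn.leftInvOn_invFunOn (show (0 : ℝ) ∈ Ioo (-1) 1 by norm_num)
  rw [lpTransport, relSlice_zero]
  rwa [relSlice_zero] at h

lemma lpTransport_nonneg (hq : 0 < q) (hp : 0 < p) (hr : r ∈ Ico (0 : ℝ) 1) :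
    0 ≤ lpTransport q p r := by
  have hr' : r ∈ Ioo (-1 : ℝ) 1 := ⟨by linarith [hr.1], hr.2⟩
  refine ((strictMonoOn_relSlice hp).le_iff_le (by norm_num)
    (Ioo_subset_Icc_self (lpTransport_mem hq hp hr'))).1 ?_
  rw [relSlice_lpTransport hq hp hr', relSlice_zero, ← relSlice_zero q]
  exact (strictMonoOn_relSlice hq).monotoneOn (by norm_num) (Ioo_subset_Icc_self hr') hr.1

lemma lpTransport_ne_zero (hq : 0 < q) (hp : 0 < p) (hr : r ∈ Ioo (-1 : ℝ) 1) (h0 : r ≠ 0) :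
    lpTransport q p r ≠ 0 := fun h => h0 <| (bijOn_relSlice hq).injOn hr (by norm_num) <| by
  rw [← relSlice_lpTransport hq hp hr, h, relSlice_zero, relSlice_zero]

lemma eventually_invFunOn_relSlice (hp : 0 < p) {x : ℝ} (hx : x ∈ Ioo (-1 : ℝ) 1) :
    ∀ᶠ y in 𝓝 x, Function.invFunOn (relSlice p) (Ioo (-1) 1) (relSlice p y) = y :=
  (isOpen_Ioo.eventually_mem hx).mono fun _ hy => (bijOn_relSlice hp).injOn.leftInvOn_invFunOn hy

lemma hasDerivAt_lpTransport (hq : 0 < q) (hp : 0 < p) (hr : r ∈ Ioo (-1 : ℝ) 1) :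
    HasDerivAt (lpTransport q p) (lpTransportDensity q p r) r := by
  have hx := lpTransport_mem hq hp hr
  have hinv := ((hasStrictDerivAt_relSlice hp _).to_local_left_inverse
    (div_pos (lpProfile_pos hp hx) (lpSlice_one_pos hp)).ne'
    (eventually_invFunOn_relSlice hp hx)).hasDerivAt
  rw [relSlice_lpTransport hq hp hr] at hinv
  refine (hinv.comp r (hasStrictDerivAt_relSlice hq r).hasDerivAt).congr_deriv ?_
  rw [lpTransportDensity, div_eq_inv_mul _ (lpProfile p _ / _)]

lemma contDiffAt_lpTransport (hq : 0 < q) (hp : 0 < p) (hr : r ∈ Ioo (-1 : ℝ) 1) (h0 : r ≠ 0) :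
    ContDiffAt ℝ ∞ (lpTransport q p) r := by
  have hx := lpTransport_mem hq hp hr
  have hinv := contDiffAt_of_local_left_inverse (n := ⊤) (by simp)
    (contDiffAt_relSlice hp hx (lpTransport_ne_zero hq hp hr h0))
    (hasStrictDerivAt_relSlice hp _).hasDerivAt
    (div_pos (lpProfile_pos hp hx) (lpSlice_one_pos hp)).ne' (eventually_invFunOn_relSlice hp hx)
  rw [relSlice_lpTransport hq hp hr] at hinv
  exact hinv.comp r (contDiffAt_relSlice hq hr h0)

lemma lpTransportDensity_pos (hq : 0 < q) (hp : 0 < p) (hr : r ∈ Ioo (-1 : ℝ) 1) :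
    0 < lpTransportDensity q p r :=
  div_pos (div_pos (lpProfile_pos hq hr) (lpSlice_one_pos hq))
    (div_pos (lpProfile_pos hp (lpTransport_mem hq hp hr)) (lpSlice_one_pos hp))

lemma continuousAt_lpTransportDensity (hq : 0 < q) (hp : 0 < p) (hr : r ∈ Ioo (-1 : ℝ) 1) :
    ContinuousAt (lpTransportDensity q p) r :=
  ((continuous_lpProfile hq).continuousAt.div_const _).div
    (((continuous_lpProfile hp).continuousAt.comp
      (hasDerivAt_lpTransport hq hp hr).continuousAt).div_const _)
    (div_pos (lpProfile_pos hp (lpTransport_mem hq hp hr)) (lpSlice_one_pos hp)).ne'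

lemma contDiffAt_lpTransportDensity (hq : 0 < q) (hp : 0 < p) (hr : r ∈ Ioo (-1 : ℝ) 1)
    (h0 : r ≠ 0) : ContDiffAt ℝ ∞ (lpTransportDensity q p) r :=
  ((contDiffAt_lpProfile hq hr h0).div_const _).div
    (((contDiffAt_lpProfile hp (lpTransport_mem hq hp hr) (lpTransport_ne_zero hq hp hr h0)).comp r
      (contDiffAt_lpTransport hq hp hr h0)).div_const _)
    (div_pos (lpProfile_pos hp (lpTransport_mem hq hp hr)) (lpSlice_one_pos hp)).ne'

lemma lpTransportDensity_mul_lpProfile (hq : 0 < q) (hp : 0 < p) (hr : r ∈ Ioo (-1 : ℝ) 1) :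
    lpTransportDensity q p r * lpProfile p (lpTransport q p r) =
      lpSlice p 1 / lpSlice q 1 * lpProfile q r := by
  have := (lpProfile_pos hp (lpTransport_mem hq hp hr)).ne'
  have := (lpSlice_one_pos hp).ne'
  rw [lpTransportDensity]
  field_simp

lemma mul_mul_lpProfile_le_lpTransport_mul (hq : 0 < q) (hqp : q ≤ p) (hr : r ∈ Ico (0 : ℝ) 1) :
    lpSlice p 1 / lpSlice q 1 * (r * lpProfile q r) ≤
      lpTransport q p r * lpProfile p (lpTransport q p r) := by
  have hp := hq.trans_le hqp
  have hr' : r ∈ Ioo (-1 : ℝ) 1 := ⟨by linarith [hr.1], hr.2⟩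
  have hx : lpTransport q p r ∈ Ico (0 : ℝ) 1 :=
    ⟨lpTransport_nonneg hq hp hr, (lpTransport_mem hq hp hr').2⟩
  have h := relRect_le_relRect_of_relSlice_eq hq hqp hx hr (relSlice_lpTransport hq hp hr')
  rw [relRect_rpow hp (Ico_subset_Icc_self hx), relRect_rpow hq (Ico_subset_Icc_self hr),
    le_div_iff₀ (lpSlice_one_pos hp)] at h
  calc _ = r * lpProfile q r / lpSlice q 1 * lpSlice p 1 := by ring
    _ ≤ _ := h

/-- Smoothing shrinks `|X|`, where `X = lpTransport q p`, and the target profile decreases with the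
distance to the origin; so the estimates for `X` survive up to a factor close to `1`. -/
lemma exists_smooth_transport (hq : 0 < q) (hp : 0 < p) (hc : 0 < c)
    (hlt : c * lpSlice q 1 < lpSlice p 1) :
    ∃ Y : ℝ → ℝ, ContDiffOn ℝ ∞ Y (Ioo (-1) 1) ∧ (∃ k, ∀ᶠ r in 𝓝 0, Y r = k * r) ∧
      ∀ r ∈ Ioo (-1 : ℝ) 1, Y r ∈ Ioo (-1 : ℝ) 1 ∧ 0 < deriv Y r ∧
        c * lpProfile q r ≤ deriv Y r * lpProfile p (Y r) ∧
        (q ≤ p → 0 ≤ r → c * (r * lpProfile q r) ≤ |Y r| * lpProfile p (Y r)) := by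
  have hKp := lpSlice_one_pos hp
  have hKq := lpSlice_one_pos hq
  obtain ⟨η, hη, hη1⟩ := exists_between ((div_lt_one hKp).2 hlt)
  have hη0 : 0 < η := lt_trans (by positivity) hη
  have hcη : c ≤ η * (lpSlice p 1 / lpSlice q 1) := by
    rw [← mul_div_assoc, le_div_iff₀ hKq]
    exact ((div_lt_iff₀ hKp).1 hη).le
  obtain ⟨Y, hY, hlin, hbd⟩ := exists_smoothing hη0 hη1
    (fun r hr => hasDerivAt_lpTransport hq hp hr) (lpTransport_zero hp q)
    (fun r hr => lpTransportDensity_pos hq hp hr)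
    (continuousAt_lpTransportDensity hq hp (by norm_num))
    fun r hr => contDiffAt_lpTransportDensity hq hp hr
  refine ⟨Y, hY, hlin, fun r hr => ?_⟩
  obtain ⟨⟨hD, -⟩, hXY, hYX⟩ := hbd r hr
  have hX := lpTransport_mem hq hp hr
  have hXprofile := (lpProfile_pos hp hX).le
  have hqprofile := (lpProfile_pos hq hr).le
  have hprofile := lpProfile_le_lpProfile hp hYX hX
  have hY' : 0 < deriv Y r := (mul_pos hη0 (lpTransportDensity_pos hq hp hr)).trans_le hD
  refine ⟨abs_lt.1 (hYX.trans_lt (abs_lt.2 hX)), hY', ?_, fun hqp hr0 => ?_⟩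
  · calc c * lpProfile q r ≤ η * (lpSlice p 1 / lpSlice q 1) * lpProfile q r := by gcongr
      _ = η * lpTransportDensity q p r * lpProfile p (lpTransport q p r) := by
        rw [mul_assoc, ← lpTransportDensity_mul_lpProfile hq hp hr, mul_assoc]
      _ ≤ deriv Y r * lpProfile p (Y r) := by gcongr
  · calc c * (r * lpProfile q r)
        ≤ η * (lpSlice p 1 / lpSlice q 1) * (r * lpProfile q r) := by gcongr
      _ = η * (lpSlice p 1 / lpSlice q 1 * (r * lpProfile q r)) := mul_assoc _ _ _
      _ ≤ η * (lpTransport q p r * lpProfile p (lpTransport q p r)) :=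
        mul_le_mul_of_nonneg_left (mul_mul_lpProfile_le_lpTransport_mul hq hqp ⟨hr0, hr.2⟩) hη0.le
      _ = η * |lpTransport q p r| * lpProfile p (lpTransport q p r) := by
        rw [abs_of_nonneg (lpTransport_nonneg hq hp ⟨hr0, hr.2⟩), mul_assoc]
      _ ≤ |Y r| * lpProfile p (Y r) := by gcongr

end Transport

section CotangentLift

lemma omega_eq_inner {n : ℕ} (u v : PhaseSpace n) :
    omega u v = inner ℝ u.1 v.2 - inner ℝ v.1 u.2 := by
  simp only [omega, PiLp.inner_apply, RCLike.inner_apply, conj_trivial, ← Finset.sum_sub_distrib]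
  exact Finset.sum_congr rfl fun i _ => by ring

lemma inner_fderiv_add_eq_zero_of_eventually_inner_eq {E F G H : Type*}
    [NormedAddCommGroup E] [NormedSpace ℝ E] [NormedAddCommGroup F] [InnerProductSpace ℝ F]
    [NormedAddCommGroup G] [NormedSpace ℝ G] [NormedAddCommGroup H] [NormedSpace ℝ H]
    {A : E → G →L[ℝ] F} {B : E → H →L[ℝ] F} {A' : E →L[ℝ] G →L[ℝ] F} {B' : E →L[ℝ] H →L[ℝ] F}
    {x : E} {a : G} {y : H} {κ : ℝ} (hA : HasFDerivAt A A' x) (hB : HasFDerivAt B B' x)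
    (h : ∀ᶠ x in 𝓝 x, inner ℝ (A x a) (B x y) = κ) (b : E) :
    inner ℝ (A' b a) (B x y) + inner ℝ (A x a) (B' b y) = 0 := by
  have hAa : HasFDerivAt (fun x => A x a) (A'.flip a) x := by
    simpa using hA.clm_apply (hasFDerivAt_const a x)
  have hBy : HasFDerivAt (fun x => B x y) (B'.flip y) x := by
    simpa using hB.clm_apply (hasFDerivAt_const y x)
  have hzero := (hasFDerivAt_const (𝕜 := ℝ) κ x).congr_of_eventuallyEq h
  have hb := congrArg (fun T : E →L[ℝ] ℝ => T b) ((hAa.inner ℝ hBy).unique hzero)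
  simpa [fderivInnerCLM_apply, add_comm] using hb

lemma hasFDerivAt_cotangentLift {E F G H : Type*} [NormedAddCommGroup E] [NormedSpace ℝ E]
    [NormedAddCommGroup F] [NormedSpace ℝ F] [NormedAddCommGroup G] [NormedSpace ℝ G]
    [NormedAddCommGroup H] [NormedSpace ℝ H] {Φ : E → G} {M : E → F →L[ℝ] H} {Φ' : E →L[ℝ] G}
    {M' : E →L[ℝ] F →L[ℝ] H} {x : E} (hΦ : HasFDerivAt Φ Φ' x) (hM : HasFDerivAt M M' x) (y : F) :
    HasFDerivAt (fun z : E × F => (Φ z.1, M z.1 z.2))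
      ((Φ' ∘L .fst ℝ E F).prod (M x ∘L .snd ℝ E F + (M' ∘L .fst ℝ E F).flip y)) (x, y) :=
  (HasFDerivAt.comp (x, y) (f := Prod.fst) (g := Φ) hΦ hasFDerivAt_fst).prodMk <|
    (HasFDerivAt.comp (x, y) (f := Prod.fst) (g := M) hM hasFDerivAt_fst).clm_apply hasFDerivAt_snd

variable {n : ℕ} {W : Set (EuclideanSpace ℝ (Fin n))}
  {Φ : EuclideanSpace ℝ (Fin n) → EuclideanSpace ℝ (Fin n)}
  {M : EuclideanSpace ℝ (Fin n) → EuclideanSpace ℝ (Fin n) →L[ℝ] EuclideanSpace ℝ (Fin n)}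

lemma omega_fderiv_cotangentLift (hW : IsOpen W) (hΦ : ContDiffOn ℝ ∞ Φ W) (hM : ContDiffOn ℝ ∞ M W)
    (hdual : ∀ x ∈ W, ∀ u y, inner ℝ (fderiv ℝ Φ x u) (M x y) = inner ℝ u y) {z : PhaseSpace n}
    (hz : z.1 ∈ W) (u v : PhaseSpace n) :
    omega (fderiv ℝ (fun z : PhaseSpace n => (Φ z.1, M z.1 z.2)) z u)
      (fderiv ℝ (fun z : PhaseSpace n => (Φ z.1, M z.1 z.2)) z v) = omega u v := by
  obtain ⟨x, y⟩ := z
  have hΦx : ContDiffAt ℝ ∞ Φ x := hΦ.contDiffAt (hW.mem_nhds hz)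
  have dΦ : HasFDerivAt Φ (fderiv ℝ Φ x) x := (hΦx.differentiableAt (by simp)).hasFDerivAt
  have dM : HasFDerivAt M (fderiv ℝ M x) x :=
    ((hM.contDiffAt (hW.mem_nhds hz)).differentiableAt (by simp)).hasFDerivAt
  have ddΦ : HasFDerivAt (fderiv ℝ Φ) (fderiv ℝ (fderiv ℝ Φ) x) x :=
    ((hΦx.fderiv_right (m := 1) (by norm_cast)).differentiableAt (by simp)).hasFDerivAt
  have hcross : ∀ a b, inner ℝ (fderiv ℝ (fderiv ℝ Φ) x b a) (M x y) +
      inner ℝ (fderiv ℝ Φ x a) (fderiv ℝ M x b y) = 0 := fun a b =>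
    inner_fderiv_add_eq_zero_of_eventually_inner_eq ddΦ dM
      ((hW.eventually_mem hz).mono fun x hx => hdual x hx a y) b
  have hsymm := (hΦx.isSymmSndFDerivAt (by
    rw [minSmoothness_of_isRCLikeNormedField]
    exact WithTop.coe_le_coe.2 (le_top (a := (2 : ℕ∞))))).eq u.1 v.1
  have huv := hcross u.1 v.1
  have hvu := hcross v.1 u.1
  rw [hsymm] at hvu
  rw [(hasFDerivAt_cotangentLift dΦ dM y).fderiv, omega_eq_inner, omega_eq_inner]
  simp only [ContinuousLinearMap.prod_apply, ContinuousLinearMap.comp_apply, add_apply,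
    ContinuousLinearMap.flip_apply, ContinuousLinearMap.coe_fst', ContinuousLinearMap.coe_snd',
    inner_add_right, hdual x hz]
  linarith

/-- The cotangent lift `(x, y) ↦ (Φ x, (DΦ(x)ᵀ)⁻¹ y)`; the inverse transpose `M` enters through the
duality `hdual`. -/
lemma symplecticallyEmbeds_of_cotangentLift {U V : TopologicalSpace.Opens (PhaseSpace n)}
    (hW : IsOpen W) (hΦ : ContDiffOn ℝ ∞ Φ W) (hM : ContDiffOn ℝ ∞ M W) (hinj : InjOn Φ W)
    (hdual : ∀ x ∈ W, ∀ u y, inner ℝ (fderiv ℝ Φ x u) (M x y) = inner ℝ u y)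
    (hU : ∀ z ∈ U, z.1 ∈ W) (hmaps : ∀ z ∈ U, (Φ z.1, M z.1 z.2) ∈ V) :
    SymplecticallyEmbeds U V := by
  refine ⟨fun z => (Φ z.1, M z.1 z.2), (hΦ.comp contDiffOn_fst hU).prodMk
    ((hM.comp contDiffOn_fst hU).clm_apply contDiffOn_snd), hmaps, ?_,
    fun z hz => omega_fderiv_cotangentLift hW hΦ hM hdual (hU z hz)⟩
  rintro ⟨x, y⟩ hz ⟨x', y'⟩ hz' h
  obtain ⟨hΦxx', hMyy'⟩ := Prod.mk.inj h
  obtain rfl : x = x' := hinj (hU _ hz) (hU _ hz') hΦxx'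
  congr 1
  refine ext_inner_left ℝ fun u => ?_
  rw [← hdual x (hU _ hz) u y, ← hdual x (hU _ hz) u y', hMyy']

end CotangentLift

section Radial

lemma norm_mem_Ioo_of_mem_ball {E : Type*} [SeminormedAddCommGroup E] {x : E} {l : ℝ}
    (hx : x ∈ Metric.ball 0 l) : ‖x‖ ∈ Ioo (-l) l := by
  have h := mem_ball_zero_iff.1 hx
  exact ⟨by linarith [norm_nonneg x], h⟩

variable {E : Type*} [NormedAddCommGroup E] [InnerProductSpace ℝ E]

/-- The linear map with eigenvalue `s` on the line of `x` and `t` on its orthogonal complement; for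
`x = 0` it is `t • id`, since the division by `‖x‖ ^ 2 = 0` gives `0`. -/
noncomputable def radialScaling (s t : ℝ) (x : E) : E →L[ℝ] E :=
  t • ContinuousLinearMap.id ℝ E + ((s - t) / ‖x‖ ^ 2) • (innerSL ℝ x).smulRight x

lemma radialScaling_apply (s t : ℝ) (x u : E) :
    radialScaling s t x u = t • u + ((s - t) / ‖x‖ ^ 2 * inner ℝ x u) • x := by
  simp [radialScaling, smul_smul]

lemma radialScaling_self (t : ℝ) (x : E) :
    radialScaling t t x = t • ContinuousLinearMap.id ℝ E := by
  simp [radialScaling]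

lemma inner_radialScaling_radialScaling (s t s' t' : ℝ) (x u y : E) :
    inner ℝ (radialScaling s t x u) (radialScaling s' t' x y) =
      t * t' * inner ℝ u y + (s * s' - t * t') * (inner ℝ x u * inner ℝ x y / ‖x‖ ^ 2) := by
  simp only [radialScaling_apply, inner_add_left, inner_add_right, inner_smul_left,
    inner_smul_right, conj_trivial, real_inner_self_eq_norm_sq, real_inner_comm x u]
  rcases eq_or_ne x 0 with rfl | hx
  · simp only [norm_zero, ne_eq, OfNat.ofNat_ne_zero, not_false_eq_true, zero_pow, div_zero,
      inner_zero_left, mul_zero, add_zero]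
    ring
  · have : ‖x‖ ≠ 0 := norm_ne_zero_iff.2 hx
    field_simp
    ring

lemma inner_radialScaling_inv {s t : ℝ} (hs : s ≠ 0) (ht : t ≠ 0) (x u y : E) :
    inner ℝ (radialScaling s t x u) (radialScaling s⁻¹ t⁻¹ x y) = inner ℝ u y := by
  rw [inner_radialScaling_radialScaling, mul_inv_cancel₀ hs, mul_inv_cancel₀ ht, sub_self, zero_mul,
    add_zero, one_mul]

lemma norm_radialScaling_le {s t C : ℝ} (hs : |s| ≤ C) (ht : |t| ≤ C) (x y : E) :
    ‖radialScaling s t x y‖ ≤ C * ‖y‖ := by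
  have hC : 0 ≤ C := (abs_nonneg s).trans hs
  have hs2 : s * s ≤ C ^ 2 := by simpa [sq_abs, sq] using pow_le_pow_left₀ (abs_nonneg s) hs 2
  have ht2 : t * t ≤ C ^ 2 := by simpa [sq_abs, sq] using pow_le_pow_left₀ (abs_nonneg t) ht 2
  have hproj : 0 ≤ inner ℝ x y * inner ℝ x y / ‖x‖ ^ 2 :=
    div_nonneg (mul_self_nonneg _) (sq_nonneg _)
  have hproj_le : inner ℝ x y * inner ℝ x y / ‖x‖ ^ 2 ≤ ‖y‖ ^ 2 := by
    refine div_le_of_le_mul₀ (sq_nonneg _) (sq_nonneg _) ?_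
    rw [mul_comm (‖y‖ ^ 2), ← real_inner_self_eq_norm_sq, ← real_inner_self_eq_norm_sq]
    exact real_inner_mul_inner_self_le x y
  refine le_of_sq_le_sq ?_ (by positivity)
  rw [← real_inner_self_eq_norm_sq, inner_radialScaling_radialScaling, real_inner_self_eq_norm_sq,
    mul_pow]
  nlinarith [mul_le_mul_of_nonneg_right hs2 hproj,
    mul_le_mul_of_nonneg_right ht2 (sub_nonneg.2 hproj_le)]

lemma hasFDerivAt_norm {x : E} (hx : x ≠ 0) : HasFDerivAt (‖·‖) (‖x‖⁻¹ • innerSL ℝ x) x := by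
  have h := (hasStrictFDerivAt_norm_sq x).hasFDerivAt.sqrt (pow_ne_zero 2 (norm_ne_zero_iff.2 hx))
  simp only [Real.sqrt_sq (norm_nonneg _)] at h
  refine h.congr_fderiv ?_
  ext u
  simp only [one_div, mul_inv_rev, smul_apply, coe_innerSL_apply, nsmul_eq_mul, Nat.cast_ofNat,
    smul_eq_mul]
  field_simp

variable {Y f : ℝ → ℝ} {l f' : ℝ} {x : E}

lemma hasFDerivAt_comp_norm_smul (hf : HasDerivAt f f' ‖x‖) (hx : x ≠ 0) :
    HasFDerivAt (fun x : E => f ‖x‖ • x) (radialScaling (f ‖x‖ + f' * ‖x‖) (f ‖x‖) x) x := by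
  have hx' : ‖x‖ ≠ 0 := norm_ne_zero_iff.2 hx
  have hfnorm : HasFDerivAt (fun x : E => f ‖x‖) _ x := hf.comp_hasFDerivAt x (hasFDerivAt_norm hx)
  refine (hfnorm.smul (hasFDerivAt_id (𝕜 := ℝ) x)).congr_fderiv ?_
  ext u
  rw [radialScaling_apply]
  simp only [smul_smul, id_eq, add_apply, smul_apply, ContinuousLinearMap.id_apply,
    ContinuousLinearMap.smulRight_apply, coe_innerSL_apply, smul_eq_mul]
  congr 2
  field_simp
  ring

lemma contDiffAt_comp_norm (hf : x ≠ 0 → ContDiffAt ℝ ∞ f ‖x‖) (h0 : ∃ k, ∀ᶠ r in 𝓝 0, f r = k) :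
    ContDiffAt ℝ ∞ (fun x : E => f ‖x‖) x := by
  rcases eq_or_ne x 0 with rfl | hx
  · obtain ⟨k, hk⟩ := h0
    exact contDiffAt_const.congr_of_eventuallyEq (tendsto_norm_zero.eventually hk)
  · exact (hf hx).comp x (contDiffAt_norm ℝ hx)

lemma contDiffAt_deriv_comp_norm (hY : ContDiffOn ℝ ∞ Y (Ioo (-l) l))
    (hlin : ∃ k, ∀ᶠ r in 𝓝 0, Y r = k * r) (hx : x ∈ Metric.ball (0 : E) l) :
    ContDiffAt ℝ ∞ (fun x : E => deriv Y ‖x‖) x :=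
  contDiffAt_comp_norm
    (fun _ => ((contDiffOn_infty_iff_deriv_of_isOpen isOpen_Ioo).1 hY).2.contDiffAt
      (isOpen_Ioo.mem_nhds (norm_mem_Ioo_of_mem_ball hx)))
    (hlin.imp fun _ => eventually_deriv_eq)

lemma contDiffAt_dslope_comp_norm (hY : ContDiffOn ℝ ∞ Y (Ioo (-l) l))
    (hlin : ∃ k, ∀ᶠ r in 𝓝 0, Y r = k * r) (hx : x ∈ Metric.ball (0 : E) l) :
    ContDiffAt ℝ ∞ (fun x : E => dslope Y 0 ‖x‖) x :=
  contDiffAt_comp_norm (fun h => contDiffAt_dslope_of_ne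
    (hY.contDiffAt (isOpen_Ioo.mem_nhds (norm_mem_Ioo_of_mem_ball hx))) (norm_ne_zero_iff.2 h))
    (hlin.imp fun _ => eventually_dslope_zero_eq)

lemma contDiffAt_radialScaling {s t : E → ℝ} (hs : ContDiffAt ℝ ∞ s x) (ht : ContDiffAt ℝ ∞ t x)
    (hst : x = 0 → s =ᶠ[𝓝 0] t) : ContDiffAt ℝ ∞ (fun x => radialScaling (s x) (t x) x) x := by
  rcases eq_or_ne x 0 with rfl | hx
  · refine (ht.smul (contDiffAt_const (c := ContinuousLinearMap.id ℝ E))).congr_of_eventuallyEq ?_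
    filter_upwards [hst rfl] with y hy
    rw [hy, radialScaling_self]
    rfl
  · exact (ht.smul contDiffAt_const).add <|
      ((hs.sub ht).div ((contDiffAt_norm ℝ hx).pow 2) (pow_ne_zero 2 (norm_ne_zero_iff.2 hx))).smul
        ((innerSL ℝ).contDiff.contDiffAt.smulRight contDiffAt_id)

/-- The map that preserves directions and acts on distances to the origin by `Y`. -/
noncomputable def radialMap (Y : ℝ → ℝ) (x : E) : E := dslope Y 0 ‖x‖ • x

lemma norm_radialMap (hY0 : Y 0 = 0) (x : E) : ‖radialMap Y x‖ = |Y ‖x‖| := by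
  rw [← dslope_zero_mul hY0, abs_mul, abs_norm, radialMap, norm_smul, Real.norm_eq_abs]

lemma hasFDerivAt_radialMap (hY : DifferentiableAt ℝ Y ‖x‖) (h0 : ∃ k, ∀ᶠ r in 𝓝 0, Y r = k * r) :
    HasFDerivAt (radialMap Y) (radialScaling (deriv Y ‖x‖) (dslope Y 0 ‖x‖) x) x := by
  obtain ⟨k, hk⟩ := h0
  rcases eq_or_ne x 0 with rfl | hx
  · have hlin : radialMap Y =ᶠ[𝓝 (0 : E)] fun x => k • x :=
      (tendsto_norm_zero.eventually (eventually_dslope_zero_eq hk)).mono fun x hx => by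
        rw [radialMap, hx]
    rw [norm_zero, dslope_same, radialScaling_self, (eventually_deriv_eq hk).self_of_nhds]
    exact ((hasFDerivAt_id (𝕜 := ℝ) (0 : E)).const_smul k).congr_of_eventuallyEq hlin
  · have hx' : ‖x‖ ≠ 0 := norm_ne_zero_iff.2 hx
    rw [deriv_eq_dslope_zero_add (by simpa using hk.self_of_nhds) hY hx']
    exact hasFDerivAt_comp_norm_smul ((differentiableAt_dslope_of_ne hx').2 hY).hasDerivAt hx

lemma injOn_radialMap (hY : ContDiffOn ℝ ∞ Y (Ioo (-l) l)) (hY' : ∀ r ∈ Ioo (-l) l, 0 < deriv Y r)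
    (hY0 : Y 0 = 0) : InjOn (radialMap Y) (Metric.ball (0 : E) l) := by
  have hmono : StrictMonoOn Y (Ioo (-l) l) :=
    strictMonoOn_of_deriv_pos (convex_Ioo _ _) hY.continuousOn (by rwa [interior_Ioo])
  intro x hx y hy hxy
  have hxl := norm_mem_Ioo_of_mem_ball hx
  have hyl := norm_mem_Ioo_of_mem_ball hy
  have hl : 0 < l := Metric.pos_of_mem_ball hx
  have h0 : (0 : ℝ) ∈ Ioo (-l) l := ⟨by linarith, hl⟩
  have hYnonneg : ∀ r ∈ Ioo (-l) l, 0 ≤ r → 0 ≤ Y r := fun r hr h =>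
    hY0 ▸ hmono.monotoneOn h0 hr h
  have hnorm : ‖x‖ = ‖y‖ := by
    have h := congrArg norm hxy
    rw [norm_radialMap hY0, norm_radialMap hY0, abs_of_nonneg (hYnonneg _ hxl (norm_nonneg x)),
      abs_of_nonneg (hYnonneg _ hyl (norm_nonneg y))] at h
    exact hmono.injOn hxl hyl h
  rw [radialMap, radialMap, hnorm] at hxy
  exact smul_right_injective E (dslope_pos_of_deriv_pos isOpen_Ioo (convex_Ioo _ _)
    hY.continuousOn hY' h0 hyl).ne' hxy

end Radial

section RadialEmbedding

variable {Y : ℝ → ℝ} {l : ℝ}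

/-- `w` stands for the image of `z` under the cotangent lift of `radialMap Y`, which divides the
radial momentum by `deriv Y ‖z.1‖` and the orthogonal one by `dslope Y 0 ‖z.1‖`. -/
lemma symplecticallyEmbeds_of_radialMap {n : ℕ} {U V : TopologicalSpace.Opens (PhaseSpace n)}
    (hY : ContDiffOn ℝ ∞ Y (Ioo (-l) l)) (hY' : ∀ r ∈ Ioo (-l) l, 0 < deriv Y r)
    (hlin : ∃ k, ∀ᶠ r in 𝓝 0, Y r = k * r) (hU : ∀ z ∈ U, ‖z.1‖ < l)
    (hmaps : ∀ z ∈ U, ∀ w : PhaseSpace n, ‖w.1‖ = |Y ‖z.1‖| →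
      min (deriv Y ‖z.1‖) (dslope Y 0 ‖z.1‖) * ‖w.2‖ ≤ ‖z.2‖ → w ∈ V) :
    SymplecticallyEmbeds U V := by
  have hY0 : Y 0 = 0 := by
    obtain ⟨k, hk⟩ := hlin
    simpa using hk.self_of_nhds
  have hYat : ∀ r ∈ Ioo (-l) l, ContDiffAt ℝ ∞ Y r := fun r hr =>
    hY.contDiffAt (isOpen_Ioo.mem_nhds hr)
  have hslope : ∀ r ∈ Ioo (-l) l, 0 < dslope Y 0 r := fun r hr =>
    dslope_pos_of_deriv_pos isOpen_Ioo (convex_Ioo _ _) hY.continuousOn hY'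
      ⟨by linarith [hr.1, hr.2], by linarith [hr.1, hr.2]⟩ hr
  refine symplecticallyEmbeds_of_cotangentLift Metric.isOpen_ball (Φ := radialMap Y)
    (M := fun x => radialScaling (deriv Y ‖x‖)⁻¹ (dslope Y 0 ‖x‖)⁻¹ x)
    (fun x hx => ((contDiffAt_dslope_comp_norm hY hlin hx).smul contDiffAt_id).contDiffWithinAt)
    (fun x hx => ContDiffAt.contDiffWithinAt ?_) (injOn_radialMap hY hY' hY0)
    (fun x hx u y => ?_) (fun z hz => mem_ball_zero_iff.2 (hU z hz)) fun z hz => ?_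
  · have hr := norm_mem_Ioo_of_mem_ball hx
    refine contDiffAt_radialScaling ((contDiffAt_deriv_comp_norm hY hlin hx).inv (hY' _ hr).ne')
      ((contDiffAt_dslope_comp_norm hY hlin hx).inv (hslope _ hr).ne') fun _ => ?_
    obtain ⟨k, hk⟩ := hlin
    filter_upwards [tendsto_norm_zero.eventually (eventually_deriv_eq hk),
      tendsto_norm_zero.eventually (eventually_dslope_zero_eq hk)] with y h1 h2
    rw [h1, h2]
  · have hr := norm_mem_Ioo_of_mem_ball hx
    rw [(hasFDerivAt_radialMap ((hYat _ hr).differentiableAt (by simp)) hlin).fderiv]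
    exact inner_radialScaling_inv (hY' _ hr).ne' (hslope _ hr).ne' x u y
  · have hr := norm_mem_Ioo_of_mem_ball (mem_ball_zero_iff.2 (hU z hz))
    have hmin := lt_min (hY' _ hr) (hslope _ hr)
    refine hmaps z hz _ (norm_radialMap hY0 z.1) ?_
    rw [← le_inv_mul_iff₀ hmin]
    refine norm_radialScaling_le ?_ ?_ _ _
    · rw [abs_inv, abs_of_pos (hY' _ hr)]
      exact inv_anti₀ hmin (min_le_left _ _)
    · rw [abs_inv, abs_of_pos (hslope _ hr)]
      exact inv_anti₀ hmin (min_le_right _ _)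

end RadialEmbedding

section FirstCoordinate

variable {n : ℕ} [NeZero n]

/-- The linear map multiplying the first coordinate by `s` and fixing the other ones. -/
noncomputable def firstCoordScaling (s : ℝ) :
    EuclideanSpace ℝ (Fin n) →L[ℝ] EuclideanSpace ℝ (Fin n) :=
  .id ℝ _ + (s - 1) • (EuclideanSpace.proj 0).smulRight (EuclideanSpace.single 0 1)

/-- The map acting on the first coordinate by `X` and fixing the other ones. -/
noncomputable def firstCoordMap (X : ℝ → ℝ) (x : EuclideanSpace ℝ (Fin n)) :
    EuclideanSpace ℝ (Fin n) :=
  x + (X (x 0) - x 0) • EuclideanSpace.single 0 1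

lemma firstCoordScaling_apply_zero (s : ℝ) (x : EuclideanSpace ℝ (Fin n)) :
    firstCoordScaling s x 0 = s * x 0 := by
  simp only [firstCoordScaling, add_apply, ContinuousLinearMap.id_apply, smul_apply,
    ContinuousLinearMap.smulRight_apply, PiLp.proj_apply, PiLp.add_apply, PiLp.smul_apply,
    PiLp.single_eq_same, smul_eq_mul, mul_one]
  ring

lemma firstCoordMap_apply_zero (X : ℝ → ℝ) (x : EuclideanSpace ℝ (Fin n)) :
    firstCoordMap X x 0 = X (x 0) := by
  simp [firstCoordMap]

lemma inner_firstCoordScaling_inv {s : ℝ} (hs : s ≠ 0) (u y : EuclideanSpace ℝ (Fin n)) :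
    inner ℝ (firstCoordScaling s u) (firstCoordScaling s⁻¹ y) = inner ℝ u y := by
  simp only [firstCoordScaling, add_apply, ContinuousLinearMap.id_apply, smul_apply,
    ContinuousLinearMap.smulRight_apply, PiLp.proj_apply, inner_add_right, inner_add_left,
    inner_smul_left, inner_smul_right, conj_trivial, EuclideanSpace.inner_single_left,
    EuclideanSpace.inner_single_right, PiLp.single_eq_same, mul_one, one_mul]
  field_simp
  ring

lemma hasFDerivAt_firstCoordMap {X : ℝ → ℝ} {X' : ℝ} {x : EuclideanSpace ℝ (Fin n)}
    (hX : HasDerivAt X X' (x 0)) : HasFDerivAt (firstCoordMap X) (firstCoordScaling X') x := by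
  have hproj : HasFDerivAt (fun x : EuclideanSpace ℝ (Fin n) => x 0) _ x :=
    (EuclideanSpace.proj (𝕜 := ℝ) (0 : Fin n)).hasFDerivAt
  refine ((hasFDerivAt_id x).add (((hX.comp_hasFDerivAt x hproj).sub hproj).smul_const
    (EuclideanSpace.single 0 (1 : ℝ)))).congr_fderiv ?_
  refine ContinuousLinearMap.ext fun u => ?_
  simp [firstCoordScaling, smul_smul, sub_mul]

/-- `w` stands for the image of `z` under the cotangent lift of `firstCoordMap X`. -/
lemma symplecticallyEmbeds_of_firstCoordMap {U V : TopologicalSpace.Opens (PhaseSpace n)}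
    {X : ℝ → ℝ} {s : Set ℝ} (hs : IsOpen s) (hconv : Convex ℝ s) (hX : ContDiffOn ℝ ∞ X s)
    (hX' : ∀ r ∈ s, 0 < deriv X r) (hU : ∀ z ∈ U, z.1 0 ∈ s)
    (hmaps : ∀ z ∈ U, ∀ w : PhaseSpace n, w.1 0 = X (z.1 0) →
      deriv X (z.1 0) * w.2 0 = z.2 0 → w ∈ V) :
    SymplecticallyEmbeds U V := by
  have hproj : ContDiff ℝ ∞ fun x : EuclideanSpace ℝ (Fin n) => x 0 :=
    (EuclideanSpace.proj (𝕜 := ℝ) (0 : Fin n)).contDiff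
  have hW : MapsTo (fun x : EuclideanSpace ℝ (Fin n) => x 0) {x | x 0 ∈ s} s := fun x hx => hx
  have hderiv : ContDiffOn ℝ ∞ (fun x : EuclideanSpace ℝ (Fin n) => deriv X (x 0)) {x | x 0 ∈ s} :=
    ((contDiffOn_infty_iff_deriv_of_isOpen hs).1 hX).2.comp hproj.contDiffOn hW
  refine symplecticallyEmbeds_of_cotangentLift (Φ := firstCoordMap X)
    (M := fun x => firstCoordScaling (deriv X (x 0))⁻¹) (hs.preimage hproj.continuous)
    (contDiffOn_id.add
      (((hX.comp hproj.contDiffOn hW).sub hproj.contDiffOn).smul contDiffOn_const))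
    (contDiffOn_const.add (((hderiv.inv fun x hx => (hX' _ hx).ne').sub contDiffOn_const).smul
      contDiffOn_const)) (fun x hx y hy h => ?_) (fun x hx u y => ?_) hU fun z hz => ?_
  · have h0 : x 0 = y 0 := by
      refine (strictMonoOn_of_deriv_pos hconv hX.continuousOn (by rwa [hs.interior_eq])).injOn
        hx hy ?_
      rw [← firstCoordMap_apply_zero X x, h, firstCoordMap_apply_zero]
    simpa [firstCoordMap, h0] using h
  · have hXx := ((hX.contDiffAt (hs.mem_nhds hx)).differentiableAt (by simp)).hasDerivAt
    rw [(hasFDerivAt_firstCoordMap hXx).fderiv]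
    exact inner_firstCoordScaling_inv (hX' _ hx).ne' u y
  · refine hmaps z hz _ (firstCoordMap_apply_zero X z.1) ?_
    rw [firstCoordScaling_apply_zero, mul_inv_cancel_left₀ (hX' _ (hU z hz)).ne']

end FirstCoordinate

section Area

variable {p : ℝ}

lemma setOf_sum_rpow_lt_one_eq_preimage_regionBetween (hp : 0 < p) :
    {x : Fin 2 → ℝ | ∑ i, |x i| ^ p < 1} = MeasurableEquiv.finTwoArrow ⁻¹'
      regionBetween (-lpProfile p) (lpProfile p) (Ioo (-1) 1) := by
  ext x
  simp only [mem_ofPred_eq, Fin.sum_univ_two, mem_preimage, regionBetween,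
    MeasurableEquiv.finTwoArrow_apply, mem_Ioo (a := -lpProfile p _), Pi.neg_apply, ← abs_lt]
  refine ⟨fun h => ?_, fun ⟨hs, h⟩ => (abs_lt_lpProfile_iff hp hs).1 h⟩
  have hs := mem_Ioo_of_abs_rpow_add_lt_one hp h
  exact ⟨hs, (abs_lt_lpProfile_iff hp hs).2 h⟩

lemma integral_Ioo_lpProfile (hp : 0 < p) :
    ∫ s in Ioo (-1 : ℝ) 1, lpProfile p s = 2 * lpSlice p 1 := by
  have hint : ∀ a b, IntervalIntegrable (lpProfile p) MeasureTheory.volume a b :=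
    (continuous_lpProfile hp).intervalIntegrable
  have hneg : ∫ s in (-1 : ℝ)..0, lpProfile p s = lpSlice p 1 := by
    have h := intervalIntegral.integral_comp_neg (a := 0) (b := 1) (lpProfile p)
    simp only [lpProfile_neg, neg_zero] at h
    exact h.symm
  rw [← MeasureTheory.integral_Ioc_eq_integral_Ioo,
    ← intervalIntegral.integral_of_le (by norm_num),
    ← intervalIntegral.integral_add_adjacent_intervals (hint (-1) 0) (hint 0 1), hneg, lpSlice,
    two_mul]

lemma volume_sum_rpow_lt_one_eq_lpSlice (hp : 0 < p) :
    MeasureTheory.volume {x : Fin 2 → ℝ | ∑ i, |x i| ^ p < 1} =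
      ENNReal.ofReal (4 * lpSlice p 1) := by
  have hcont := continuous_lpProfile hp
  have hint : MeasureTheory.IntegrableOn (lpProfile p) (Ioo (-1) 1) :=
    (hcont.integrableOn_Icc (a := -1) (b := 1)).mono_set Ioo_subset_Icc_self
  have hmeas := measurableSet_regionBetween hcont.measurable.neg hcont.measurable
    (measurableSet_Ioo (a := (-1 : ℝ)) (b := 1))
  rw [setOf_sum_rpow_lt_one_eq_preimage_regionBetween hp,
    (MeasureTheory.volume_preserving_finTwoArrow ℝ).measure_preimage hmeas.nullMeasurableSet,
    MeasureTheory.Measure.volume_eq_prod, volume_regionBetween_eq_integral hint.neg hint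
      measurableSet_Ioo fun s hs => neg_le_self (lpProfile_pos hp hs).le]
  simp only [Pi.sub_apply, Pi.neg_apply, sub_neg_eq_add, ← two_mul]
  rw [MeasureTheory.integral_const_mul, integral_Ioo_lpProfile hp]
  ring_nf

lemma four_mul_lpSlice_one (hp : 1 ≤ p) :
    4 * lpSlice p 1 = 4 * Real.Gamma (1 + 1 / p) ^ 2 / Real.Gamma (1 + 2 / p) := by
  have hp0 : 0 < p := one_pos.trans_le hp
  have hvol := MeasureTheory.volume_sum_rpow_lt_one (Fin 2) hp
  have hΓ := Real.Gamma_pos_of_pos (by positivity : 0 < 1 + 2 / p)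
  rw [volume_sum_rpow_lt_one_eq_lpSlice hp0, Fintype.card_fin, Nat.cast_ofNat, add_comm (1 / p),
    add_comm (2 / p), mul_pow, ENNReal.ofReal_eq_ofReal_iff
    (by linarith [lpSlice_one_pos hp0]) (by positivity)] at hvol
  rw [hvol]
  norm_num

lemma lpSlice_two_one : lpSlice 2 1 = Real.pi / 4 := by
  have h := four_mul_lpSlice_one one_le_two
  rw [div_self two_ne_zero, one_add_one_eq_two, Real.Gamma_two, div_one, add_comm,
    Real.Gamma_add_one (by norm_num), Real.Gamma_one_half_eq, mul_pow,
    Real.sq_sqrt Real.pi_pos.le] at h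
  linarith

end Area

section Embeddings

variable {n : ℕ} {p q c R : ℝ}

lemma mem_rescale {r : ℝ} (hr : 0 < r) {U : TopologicalSpace.Opens (PhaseSpace n)}
    {z : PhaseSpace n} : z ∈ rescale r hr U ↔ r⁻¹ • z ∈ U :=
  mem_smul_set_iff_inv_smul_mem₀ hr.ne' _ _

lemma norm_snd_lt_lpProfile (hp : 0 < p) {z : PhaseSpace n} (hz : z ∈ lagrangianPSum n p hp) :
    ‖z.1‖ < 1 ∧ ‖z.2‖ < lpProfile p ‖z.1‖ := by
  have h : |‖z.1‖| ^ p + |‖z.2‖| ^ p < 1 := by rwa [abs_norm, abs_norm]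
  have hx := mem_Ioo_of_abs_rpow_add_lt_one hp h
  exact ⟨hx.2, by simpa only [abs_norm] using (abs_lt_lpProfile_iff hp hx).2 h⟩

lemma norm_snd_lt_lpProfile_of_mem_rescale {r : ℝ} (hr : 0 < r) (hp : 0 < p) {z : PhaseSpace n}
    (hz : z ∈ rescale r hr (lagrangianPSum n p hp)) :
    r⁻¹ * ‖z.1‖ < 1 ∧ r⁻¹ * ‖z.2‖ < lpProfile p (r⁻¹ * ‖z.1‖) := by
  have h := norm_snd_lt_lpProfile hp ((mem_rescale hr).1 hz)
  rwa [Prod.smul_fst, Prod.smul_snd, norm_smul, norm_smul, Real.norm_of_nonneg (by positivity)] at h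

lemma abs_rpow_apply_add_lt_one (hp : 0 < p) {z : PhaseSpace n} (hz : z ∈ lagrangianPSum n p hp)
    (i : Fin n) : |z.1 i| ^ p + |z.2 i| ^ p < 1 := by
  have hz : ‖z.1‖ ^ p + ‖z.2‖ ^ p < 1 := hz
  refine lt_of_le_of_lt ?_ hz
  gcongr
  · exact PiLp.norm_apply_le z.1 i
  · exact PiLp.norm_apply_le z.2 i

lemma mem_lagrangianPSum_of_norm_snd_lt_lpProfile (hp : 0 < p) {z : PhaseSpace n} {x : ℝ}
    (hx : x ∈ Ioo (-1 : ℝ) 1) (hz1 : ‖z.1‖ = |x|) (hz2 : ‖z.2‖ < lpProfile p x) :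
    z ∈ lagrangianPSum n p hp := by
  rw [← abs_norm, abs_lt_lpProfile_iff hp hx, abs_norm, ← hz1] at hz2
  exact hz2

lemma mul_lpProfile_le_min_mul_lpProfile {Y : ℝ → ℝ} {r : ℝ} (hY0 : Y 0 = 0) (hr : 0 ≤ r)
    (hderiv : c * lpProfile q r ≤ deriv Y r * lpProfile p (Y r))
    (hrect : c * (r * lpProfile q r) ≤ |Y r| * lpProfile p (Y r)) (hslope : 0 < dslope Y 0 r)
    (hprofile : 0 ≤ lpProfile p (Y r)) :
    c * lpProfile q r ≤ min (deriv Y r) (dslope Y 0 r) * lpProfile p (Y r) := by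
  rw [min_mul_of_nonneg _ _ hprofile, le_min_iff]
  refine ⟨hderiv, ?_⟩
  rcases hr.eq_or_lt with rfl | hr
  · rwa [dslope_same]
  · have habs : |Y r| = dslope Y 0 r * r := by
      rw [← abs_of_pos (mul_pos hslope hr), dslope_zero_mul hY0]
    rw [habs] at hrect
    exact le_of_mul_le_mul_left (by linarith) hr

lemma min_deriv_dslope_comp_mul_left (Y : ℝ → ℝ) {a : ℝ} (ha : 0 < a) (x : ℝ) :
    min (deriv (fun x => Y (a * x)) x) (dslope (fun x => Y (a * x)) 0 x) =
      a * min (deriv Y (a * x)) (dslope Y 0 (a * x)) := by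
  rw [deriv_comp_mul_left, dslope_zero_comp_mul_left ha.ne', smul_eq_mul,
    mul_min_of_nonneg _ _ ha.le]

lemma rescale_lagrangianPSum_embeds {r : ℝ} (hr : 0 < r) (hq : 0 < q) (hqp : q ≤ p)
    (hlt : r ^ 2 * lpSlice q 1 < lpSlice p 1) :
    SymplecticallyEmbeds (rescale r hr (lagrangianPSum n q hq))
      (lagrangianPSum n p (hq.trans_le hqp)) := by
  have hp := hq.trans_le hqp
  obtain ⟨Y, hY, ⟨k, hk⟩, hbd⟩ := exists_smooth_transport hq hp (by positivity) hlt
  have hY0 : Y 0 = 0 := by simpa using hk.self_of_nhds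
  have hIoo : MapsTo (fun ρ => r⁻¹ * ρ) (Ioo (-r) r) (Ioo (-1) 1) := fun ρ hρ => by
    rw [mem_Ioo, ← abs_lt, abs_mul, abs_of_pos (inv_pos.2 hr), inv_mul_lt_one₀ hr]
    exact abs_lt.2 hρ
  have hslope : ∀ x ∈ Ioo (-1 : ℝ) 1, 0 < dslope Y 0 x := fun x hx =>
    dslope_pos_of_deriv_pos isOpen_Ioo (convex_Ioo _ _) hY.continuousOn
      (fun x hx => (hbd x hx).2.1) (by norm_num) hx
  refine symplecticallyEmbeds_of_radialMap (Y := fun ρ => Y (r⁻¹ * ρ)) (l := r)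
    (hY.comp (contDiff_const.mul contDiff_id).contDiffOn hIoo) (fun ρ hρ => ?_)
    ⟨k * r⁻¹, ?_⟩ (fun z hz => ?_) fun z hz w hw1 hw2 => ?_
  · rw [deriv_comp_mul_left]
    exact mul_pos (inv_pos.2 hr) (hbd _ (hIoo hρ)).2.1
  · have hcont : Tendsto (fun ρ => r⁻¹ * ρ) (𝓝 0) (𝓝 0) := by
      simpa using (continuous_const_mul r⁻¹).tendsto 0
    exact (hcont.eventually hk).mono fun ρ hρ => by rw [hρ, mul_assoc]
  · exact (inv_mul_lt_one₀ hr).1 (norm_snd_lt_lpProfile_of_mem_rescale hr hq hz).1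
  · obtain ⟨hx1, hy⟩ := norm_snd_lt_lpProfile_of_mem_rescale hr hq hz
    rw [min_deriv_dslope_comp_mul_left _ (inv_pos.2 hr)] at hw2
    set x := r⁻¹ * ‖z.1‖
    have hx0 : 0 ≤ x := by positivity
    have hx : x ∈ Ioo (-1 : ℝ) 1 := ⟨by linarith, hx1⟩
    obtain ⟨hYx, hY', hderiv, hrect⟩ := hbd x hx
    refine mem_lagrangianPSum_of_norm_snd_lt_lpProfile hp hYx hw1 <|
      lt_of_mul_lt_mul_left ?_ (lt_min hY' (hslope x hx)).le
    calc min (deriv Y x) (dslope Y 0 x) * ‖w.2‖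
        = r * (r⁻¹ * min (deriv Y x) (dslope Y 0 x) * ‖w.2‖) := by field_simp
      _ ≤ r * ‖z.2‖ := by gcongr
      _ = r ^ 2 * (r⁻¹ * ‖z.2‖) := by field_simp
      _ < r ^ 2 * lpProfile q x := by gcongr
      _ ≤ _ := mul_lpProfile_le_min_mul_lpProfile hY0 hx0 hderiv (hrect hqp hx0) (hslope x hx)
        (lpProfile_pos hp hYx).le

lemma lagrangianPSum_embeds_cylinder [NeZero n] (hp : 0 < p) (hR : 4 * lpSlice p 1 < R) :
    SymplecticallyEmbeds (lagrangianPSum n p hp) (cylinder n R) := by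
  have hR0 : 0 < R := lt_trans (by linarith [lpSlice_one_pos hp]) hR
  set σ := √(R / Real.pi) with hσ
  have hσ0 : 0 < σ := by positivity
  have hσR : Real.pi * σ ^ 2 = R := by
    rw [hσ, Real.sq_sqrt (by positivity), mul_div_cancel₀ _ Real.pi_pos.ne']
  have hlt : (σ ^ 2)⁻¹ * lpSlice p 1 < lpSlice 2 1 := by
    rw [lpSlice_two_one, inv_mul_lt_iff₀ (by positivity)]
    linarith
  obtain ⟨Y, hY, -, hbd⟩ := exists_smooth_transport hp two_pos (by positivity) hlt
  refine symplecticallyEmbeds_of_firstCoordMap (X := fun r => σ * Y r) isOpen_Ioo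
    (convex_Ioo (-1) 1) (contDiffOn_const.mul hY) (fun r hr => ?_) (fun z hz => ?_)
    fun z hz w hw1 hw2 => ?_
  · rw [deriv_const_mul_field]
    exact mul_pos hσ0 (hbd r hr).2.1
  · exact mem_Ioo_of_abs_rpow_add_lt_one hp (abs_rpow_apply_add_lt_one hp hz 0)
  · have hcoord := abs_rpow_apply_add_lt_one hp hz 0
    have hx := mem_Ioo_of_abs_rpow_add_lt_one hp hcoord
    obtain ⟨hYmem, hY', hfibre, -⟩ := hbd _ hx
    rw [deriv_const_mul_field] at hw2
    have hsnd : |σ⁻¹ * w.2 0| < lpProfile 2 (Y (z.1 0)) := by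
      refine lt_of_mul_lt_mul_left (lt_of_lt_of_le ?_ hfibre) hY'.le
      calc deriv Y (z.1 0) * |σ⁻¹ * w.2 0| = (σ ^ 2)⁻¹ * |z.2 0| := by
            rw [← hw2, abs_mul, abs_mul, abs_mul, abs_of_pos hY', abs_inv, abs_of_pos hσ0]
            field_simp
        _ < (σ ^ 2)⁻¹ * lpProfile p (z.1 0) := by
            have := (abs_lt_lpProfile_iff hp hx).2 hcoord
            gcongr
    have hdisc := (abs_lt_lpProfile_iff two_pos hYmem).1 hsnd
    simp only [Real.rpow_two, sq_abs, mul_pow, inv_pow] at hdisc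
    change Real.pi * (w.1 0 ^ 2 + w.2 0 ^ 2) < R
    calc Real.pi * (w.1 0 ^ 2 + w.2 0 ^ 2)
        = R * (Y (z.1 0) ^ 2 + (σ ^ 2)⁻¹ * w.2 0 ^ 2) := by rw [hw1, ← hσR]; field_simp
      _ < R := mul_lt_of_lt_one_right hR0 hdisc

lemma ball_eq_rescale_lagrangianPSum (n : ℕ) (hR : 0 < R) :
    ball n R = rescale (√(R / Real.pi)) (by positivity) (lagrangianPSum n 2 two_pos) := by
  ext z
  change Real.pi * (‖z.1‖ ^ 2 + ‖z.2‖ ^ 2) < R ↔ _ ∈ rescale _ _ _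
  rw [mem_rescale]
  change _ ↔ ‖_ • z.1‖ ^ (2 : ℝ) + ‖_ • z.2‖ ^ (2 : ℝ) < 1
  rw [Real.rpow_two, Real.rpow_two, norm_smul, norm_smul, mul_pow, mul_pow, ← mul_add, norm_inv,
    inv_pow, Real.norm_eq_abs, sq_abs, Real.sq_sqrt (by positivity),
    inv_mul_lt_iff₀ (by positivity), mul_one, lt_div_iff₀' Real.pi_pos]

end Embeddings

section Capacities

variable {n : ℕ}

lemma rescale_ball {R : ℝ} (hR : 0 < R) :
    rescale (√R) (Real.sqrt_pos.2 hR) (ball n 1) = ball n R := by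
  ext z
  change z ∈ rescale _ _ _ ↔ Real.pi * (‖z.1‖ ^ 2 + ‖z.2‖ ^ 2) < R
  rw [mem_rescale]
  change Real.pi * (‖_ • z.1‖ ^ 2 + ‖_ • z.2‖ ^ 2) < 1 ↔ _
  rw [norm_smul, norm_smul, mul_pow, mul_pow, norm_inv, inv_pow, Real.norm_eq_abs, sq_abs,
    Real.sq_sqrt hR.le, ← mul_add, mul_left_comm, inv_mul_lt_iff₀ hR, mul_one]

lemma rescale_cylinder [NeZero n] {R : ℝ} (hR : 0 < R) :
    rescale (√R) (Real.sqrt_pos.2 hR) (cylinder n 1) = cylinder n R := by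
  ext z
  change z ∈ rescale _ _ _ ↔ Real.pi * (z.1 0 ^ 2 + z.2 0 ^ 2) < R
  rw [mem_rescale]
  change Real.pi * ((_ * z.1 0) ^ 2 + (_ * z.2 0) ^ 2) < 1 ↔ _
  rw [mul_pow, mul_pow, inv_pow, Real.sq_sqrt hR.le, ← mul_add, mul_left_comm,
    inv_mul_lt_iff₀ hR, mul_one]

lemma IsNormalizedCapacity.gromovWidth_le [NeZero n]
    {c : TopologicalSpace.Opens (PhaseSpace n) → ℝ≥0∞} (hc : IsNormalizedCapacity c)
    (U : TopologicalSpace.Opens (PhaseSpace n)) : gromovWidth U ≤ c U := by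
  refine sSup_le ?_
  rintro _ ⟨R, hR, hemb, rfl⟩
  have h := hc.monotone _ _ hemb
  rwa [← rescale_ball hR, hc.rescaling, hc.ball_eq_one, mul_one, Real.sq_sqrt hR.le] at h

lemma IsNormalizedCapacity.le_cylindricalCapacity [NeZero n]
    {c : TopologicalSpace.Opens (PhaseSpace n) → ℝ≥0∞} (hc : IsNormalizedCapacity c)
    (U : TopologicalSpace.Opens (PhaseSpace n)) : c U ≤ cylindricalCapacity U := by
  refine le_sInf ?_
  rintro _ ⟨R, hR, hemb, rfl⟩
  have h := hc.monotone _ _ hemb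
  rwa [← rescale_cylinder hR, hc.rescaling, hc.cylinder_eq_one, mul_one, Real.sq_sqrt hR.le] at h

lemma ofReal_le_gromovWidth {U : TopologicalSpace.Opens (PhaseSpace n)} {A : ℝ}
    (h : ∀ R, 0 < R → R < A → SymplecticallyEmbeds (ball n R) U) :
    ENNReal.ofReal A ≤ gromovWidth U := by
  refine le_of_forall_lt_imp_le_of_dense fun e he => ?_
  rcases eq_or_ne e 0 with rfl | he0
  · exact zero_le
  have htop : e ≠ ⊤ := ne_top_of_lt he
  have hpos := ENNReal.toReal_pos he0 htop
  exact le_sSup ⟨e.toReal, hpos, h _ hpos ((ENNReal.lt_ofReal_iff_toReal_lt htop).1 he),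
    (ENNReal.ofReal_toReal htop).symm⟩

lemma cylindricalCapacity_le_ofReal [NeZero n] {U : TopologicalSpace.Opens (PhaseSpace n)} {A : ℝ}
    (hA : 0 ≤ A) (h : ∀ R, A < R → SymplecticallyEmbeds U (cylinder n R)) :
    cylindricalCapacity U ≤ ENNReal.ofReal A := by
  refine le_of_forall_gt_imp_ge_of_dense fun e he => ?_
  rcases eq_or_ne e ⊤ with rfl | htop
  · exact le_top
  have hlt := (ENNReal.ofReal_lt_iff_lt_toReal hA htop).1 he
  exact sInf_le ⟨e.toReal, hA.trans_lt hlt, h _ hlt, (ENNReal.ofReal_toReal htop).symm⟩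

lemma ball_embeds_lagrangianPSum {p R : ℝ} (hp : 2 ≤ p) (hR : 0 < R) (hlt : R < 4 * lpSlice p 1) :
    SymplecticallyEmbeds (ball n R) (lagrangianPSum n p (two_pos.trans_le hp)) := by
  rw [ball_eq_rescale_lagrangianPSum n hR]
  refine rescale_lagrangianPSum_embeds _ two_pos hp ?_
  rw [Real.sq_sqrt (by positivity), lpSlice_two_one, div_mul_div_cancel₀ Real.pi_pos.ne']
  linarith

end Capacities

end SymplecticCapacity

theorem mainTheorem4_general (n : ℕ) [NeZero n] (p : ℝ) (hp : 2 ≤ p) :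
    (∀ c : TopologicalSpace.Opens (SymplecticCapacity.PhaseSpace n) → ENNReal,
      SymplecticCapacity.IsNormalizedCapacity c →
        c (SymplecticCapacity.lagrangianPSum n p (lt_of_lt_of_le two_pos hp)) =
          ENNReal.ofReal (4 * Real.Gamma (1 + 1 / p) ^ 2 / Real.Gamma (1 + 2 / p))) ∧
    ENNReal.ofReal (4 * Real.Gamma (1 + 1 / p) ^ 2 / Real.Gamma (1 + 2 / p)) ≤
      SymplecticCapacity.gromovWidth
        (SymplecticCapacity.lagrangianPSum n p (lt_of_lt_of_le two_pos hp)) ∧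
    SymplecticCapacity.cylindricalCapacity
        (SymplecticCapacity.lagrangianPSum n p (lt_of_lt_of_le two_pos hp)) ≤
      ENNReal.ofReal (4 * Real.Gamma (1 + 1 / p) ^ 2 / Real.Gamma (1 + 2 / p)) := by
  have hp0 : 0 < p := two_pos.trans_le hp
  rw [← SymplecticCapacity.four_mul_lpSlice_one (one_le_two.trans hp)]
  have hlow := SymplecticCapacity.ofReal_le_gromovWidth (n := n) fun R hR hlt =>
    SymplecticCapacity.ball_embeds_lagrangianPSum hp hR hlt
  have hup := SymplecticCapacity.cylindricalCapacity_le_ofReal (n := n)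
    (mul_pos four_pos (SymplecticCapacity.lpSlice_one_pos hp0)).le fun R hR =>
      SymplecticCapacity.lagrangianPSum_embeds_cylinder hp0 hR
  exact ⟨fun c hc => le_antisymm ((hc.le_cylindricalCapacity _).trans hup)
    (hlow.trans (hc.gromovWidth_le _)), hlow, hup⟩

theorem mainTheorem4 (p : ℝ) (hp : 2 ≤ p) :
    (∀ c : TopologicalSpace.Opens (SymplecticCapacity.PhaseSpace 2) → ENNReal,
      SymplecticCapacity.IsNormalizedCapacity c →
        c (SymplecticCapacity.lagrangianPSum 2 p (lt_of_lt_of_le two_pos hp)) =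
          ENNReal.ofReal (4 * Real.Gamma (1 + 1 / p) ^ 2 / Real.Gamma (1 + 2 / p))) ∧
    ENNReal.ofReal (4 * Real.Gamma (1 + 1 / p) ^ 2 / Real.Gamma (1 + 2 / p)) ≤
      SymplecticCapacity.gromovWidth
        (SymplecticCapacity.lagrangianPSum 2 p (lt_of_lt_of_le two_pos hp)) ∧
    SymplecticCapacity.cylindricalCapacity
        (SymplecticCapacity.lagrangianPSum 2 p (lt_of_lt_of_le two_pos hp)) ≤
      ENNReal.ofReal (4 * Real.Gamma (1 + 1 / p) ^ 2 / Real.Gamma (1 + 2 / p)) :=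
  mainTheorem4_general 2 p hp
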